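/- **Setting.** Let $T>0$, $M\in\mathbb N$, $p\in[1,\infty]$, $\beta>0$, and let $V\subset\mathbb Z^M$ be a finite set with at least two elements. Equip $L^1(0,T)^M$ with the norm $\|u\|_{L^1}=\int_0^T\|u(t)\|_1\,dt$. For $q\in[1,\infty]$ with Hölder conjugate $q'$ and $u\in L^1(0,T)^M$ let $$\mathrm{TV}_q(u)=\sup\Big\{\int_0^T u^\top\varphi'\,dt \;:\; \varphi\in C_c^1(0,T)^M,\ \|\varphi(t)\|_{q'}\le 1\ \text{for all } t\in(0,T)\Big\}\in[0,\infty].$$ Let $BV(0,T)^M=\{u\in L^1(0,T)^M:\mathrm{TV}_2(u)<\infty\}$, regarded as a dual Banach space in the usual way: $u_k\rightharpoonup^* u$ in $BV(0,T)^M$ means that $\int_0^T u_k^\top\varphi_0\,dt\to\int_0^T u^\top\varphi_0\,dt$ and $\int \varphi^\top\,dDu_k\to\int\varphi^\top\,dDu$ for all $\varphi_0,\varphi\in C_0(0,T)^M$, where $Du$ is the distributional derivative of $u$, a finite Radon measure. Weak-$\star$ accumulation points of a sequence are the weak-$\star$ limits of its subsequences. The set of admissible controls is $$U_{ad}=\{u\in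 BV(0,T)^M: u(t)\in V\ \text{for a.a. } t\in(0,T)\}.$$ Every $u\in U_{ad}$ has a unique minimal representation: $0=t_0<t_1<\dots<t_n=T$ and $a_1,\dots,a_n\in V$ with $a_j\neq a_{j+1}$ such that $u=a_j$ a.e. on $(t_{j-1},t_j)$. Let $F:L^1(0,T)^M\to\mathbb R$ be bounded from below and twice Fréchet differentiable. Assume that for every $v\in U_{ad}$ the derivative $F'(v)$ is represented by a gradient $\nabla F(v)\in L^\infty(0,T)^M\cap C^1(0,T)^M$, and that there is $C\ge 0$ with $|F''(\xi)[v,w]|\le C\|v\|_{L^1}\|w\|_{L^1}$ for all $\xi\in L^2(0,T)^M$ and all $v,w\in L^1(0,T)^M$. Say that $u\in U_{ad}$ with minimal representation $(n,a,t)$ is *first-order stationary* if $$\mu_j^\top\nabla F(u)(t_j)=0,\qquad \mu_j=a_j-a_{j+1},\qquad j=1,\dots,n-1 .$$ For $v\in U_{ad}$ and $\Delta>0$ let $\mathrm{TR}(v,\nabla F(v),\Delta)$ be the problem of minimizing $(\nabla F(v),u-v)_{L^2(0,T)^M}+\beta\,\mathrm{TV}_p(u)-\beta\,\mathrm{TV}_p(v)$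 over all $u\in U_{ad}$ with $\|u-v\|_{L^1}\le\Delta$. **Algorithm.** Fix $\Delta^0>0$, $\sigma\in(0,1)$ and $u^0\in U_{ad}$. In outer iteration $n$, with centre $u^n$, let $\Delta^{n,k}=2^{-k}\Delta^0$ and, for $k=0,1,2,\dots$ (inner loop), let $\tilde u^{n,k}$ be any solution of $\mathrm{TR}(u^n,\nabla F(u^n),\Delta^{n,k})$, and put $$\mathrm{pred}=(\nabla F(u^n),u^n-\tilde u^{n,k})_{L^2(0,T)^M}+\beta\,\mathrm{TV}_p(u^n)-\beta\,\mathrm{TV}_p(\tilde u^{n,k}),$$ $$\mathrm{ared}=F(u^n)+\beta\,\mathrm{TV}_p(u^n)-F(\tilde u^{n,k})-\beta\,\mathrm{TV}_p(\tilde u^{n,k}).$$ If $\mathrm{pred}\le0$, the algorithm stops. Otherwise, if $\mathrm{ared}<\sigma\,\mathrm{pred}$, the inner loop continues with $k+1$, and if $\mathrm{ared}\ge\sigma\,\mathrm{pred}$, then $u^{n+1}=\tilde u^{n,k}$ and the outer iteration $n+1$ begins. **Theorem.** Let the iterates $(u^n)_n$ be produced by this algorithm. Then $u^n\in U_{ad}$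 for all $n$, and the objective values $F(u^n)+\beta\,\mathrm{TV}_p(u^n)$ are (strictly) decreasing. Furthermore, exactly one of the following statements is true: 1. The sequence $(u^n)_n$ is finite, and its final element $u^N$ solves $\mathrm{TR}(u^N,\nabla F(u^N),\Delta)$ for some $\Delta>0$ and is first-order stationary. 2. The sequence $(u^n)_n$ is finite, the inner loop does not terminate for the final element $u^N$, and $u^N$ is first-order stationary. 3. The sequence $(u^n)_n$ is infinite and has a weak-$\star$ accumulation point in $BV(0,T)^M$. Every weak-$\star$ accumulation point $v$ of $(u^n)_n$ is feasible, i.e. $v\in U_{ad}$, and first-order stationary. For every subsequence with $u^{n_l}\rightharpoonup^* v$ in $BV(0,T)^M$ we have $u^{n_l}\to v$ in $L^1(0,T)^M$ and $\mathrm{TV}_p(u^{n_l})\to\mathrm{TV}_p(v)$; if $1<p<\infty$, then even $\mathrm{TV}_q(u^{n_l})\to\mathrm{TV}_q(v)$ for all $q\in[1,\infty]$. Furthermore, if the trust-region radii of a subsequence $(u^{n_k})_k$ are bounded away from zero (there is $\delta>0$ such that all radii used in the outer iterations with centres $u^{n_k}$, $k\in\mathbb N$, are at least $\delta$) and $\bar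 v$ is a weak-$\star$ accumulation point of $(u^{n_k})_k$, then $\bar v$ solves $\mathrm{TR}(\bar v,\nabla F(\bar v),\Delta)$ for some $\Delta>0$. -/

import Mathlib

open Set Filter Topology MeasureTheory
open scoped ENNReal ZeroAtInfty

noncomputable section

namespace SwitchingControl

/-- The `p`-norm of a vector of `ℝ^M`, for `p ∈ [1,∞]`. -/
def pNorm {M : ℕ} (p : ℝ≥0∞) (x : Fin M → ℝ) : ℝ :=
  ‖(WithLp.toLp p x : PiLp p fun _ : Fin M => ℝ)‖

/-- The space `L^1(0,T)^M`, with the norm `∫ ‖u(t)‖_1 dt`. -/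
abbrev L1Space (T : ℝ) (M : ℕ) : Type :=
  Lp (PiLp 1 fun _ : Fin M => ℝ) 1 (volume.restrict (Ioo (0 : ℝ) T))

/-- The test functions `φ ∈ C_c^1(0,T)^M` with `‖φ(t)‖_{p'} ≤ 1` for all `t`, where `p'` is the
Hölder conjugate of `p`. -/
def tvTests (T : ℝ) (M : ℕ) (p : ℝ≥0∞) : Set (ℝ → Fin M → ℝ) :=
  {φ | ContDiff ℝ 1 φ ∧ HasCompactSupport φ ∧ tsupport φ ⊆ Ioo 0 T ∧
    ∀ t, pNorm p.conjExponent (φ t) ≤ 1}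

variable {T : ℝ} {M : ℕ}

/-- The functional `TV_p` on `L^1(0,T)^M`. The supremum is taken in `[0,∞]`; the test function
`φ = 0` is admissible, so cutting negative values off does not change it. -/
def TVp (p : ℝ≥0∞) (u : L1Space T M) : ℝ≥0∞ :=
  ⨆ φ ∈ tvTests T M p,
    ENNReal.ofReal (∫ t in Ioo (0 : ℝ) T, ∑ i, u t i * deriv φ t i)

/-- The space `BV(0,T)^M`, as a subset of `L^1(0,T)^M`. -/
def BVSet (T : ℝ) (M : ℕ) : Set (L1Space T M) := {u | TVp 2 u < ⊤}

/-- The admissible controls: functions of bounded variation with values in `V` almost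
everywhere. -/
def Uad (T : ℝ) {M : ℕ} (V : Finset (Fin M → ℤ)) : Set (L1Space T M) :=
  {u | u ∈ BVSet T M ∧
    ∀ᵐ t ∂(volume.restrict (Ioo (0 : ℝ) T)), ∃ ν ∈ V, ∀ i, u t i = (ν i : ℝ)}

/-- The finite (signed, componentwise) Radon measure `D` on `(0,T)` is the distributional
derivative of `u`. -/
def IsDistribDeriv (u : L1Space T M) (D : Fin M → SignedMeasure (Ioo (0 : ℝ) T)) : Prop :=
  ∀ (i : Fin M) (φ : ℝ → ℝ), ContDiff ℝ 1 φ → HasCompactSupport φ → tsupport φ ⊆ Ioo 0 T →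
    ∫ t in Ioo (0 : ℝ) T, u t i * deriv φ t = -∫ᵛ x, φ (x : ℝ) ∂•(D i)

/-- Weak-* convergence `w k ⇀* v` in `BV(0,T)^M`, where `BV(0,T)^M` is regarded as the dual space
of a quotient of `C_0(0,T)^M × C_0(0,T)^M` through the pairing
`⟨u, (φ₀, φ)⟩ = ∫ u ⬝ φ₀ dt + ∫ φ ⬝ dDu`. -/
def WeakStarTendsto (w : ℕ → L1Space T M) (v : L1Space T M) : Prop :=
  (∀ k, w k ∈ BVSet T M) ∧ v ∈ BVSet T M ∧
  ∃ (Dw : ℕ → Fin M → SignedMeasure (Ioo (0 : ℝ) T)) (Dv : Fin M → SignedMeasure (Ioo (0 : ℝ) T)),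
    (∀ k, IsDistribDeriv (w k) (Dw k)) ∧ IsDistribDeriv v Dv ∧
    ∀ (i : Fin M) (φ : C₀(Ioo (0 : ℝ) T, ℝ)),
      Tendsto (fun k => ∫ x, w k x i * φ x ∂(volume.comap ((↑) : Ioo (0 : ℝ) T → ℝ))) atTop
        (𝓝 (∫ x, v x i * φ x ∂(volume.comap ((↑) : Ioo (0 : ℝ) T → ℝ)))) ∧
      Tendsto (fun k => ∫ᵛ x, φ x ∂•(Dw k i)) atTop (𝓝 (∫ᵛ x, φ x ∂•(Dv i)))

/-- `v` is a weak-* accumulation point of the sequence `w` in `BV(0,T)^M`. -/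
def IsWeakStarAccPt (w : ℕ → L1Space T M) (v : L1Space T M) : Prop :=
  ∃ ns : ℕ → ℕ, StrictMono ns ∧ WeakStarTendsto (w ∘ ns) v

/-- `g` is a representative of the gradient `∇F(u) ∈ L^∞(0,T)^M` that is continuously
differentiable on `(0,T)`. -/
structure IsC1Gradient (F : L1Space T M → ℝ) (u : L1Space T M) (g : ℝ → Fin M → ℝ) : Prop where
  contDiffOn : ContDiffOn ℝ 1 g (Ioo 0 T)
  memLp_top : MemLp g ⊤ (volume.restrict (Ioo (0 : ℝ) T))
  represents : ∀ w : L1Space T M,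
    fderiv ℝ F u w = ∫ t in Ioo (0 : ℝ) T, ∑ i, g t i * w t i

open Classical in
/-- The gradient `∇F(u)` as a function on `(0,T)`. It is the `C^1` representative (unique on
`(0,T)`) whenever there is one. -/
def grad (F : L1Space T M → ℝ) (u : L1Space T M) : ℝ → Fin M → ℝ :=
  if h : ∃ g, IsC1Gradient F u g then h.choose else 0

/-- The step function with the value `a j` on `[t j, t (j+1))`, for `j < n`. -/
def stepFun (n : ℕ) (t : ℕ → ℝ) (a : ℕ → Fin M → ℤ) (x : ℝ) (i : Fin M) : ℝ :=
  ∑ j ∈ Finset.range n, (Ico (t j) (t (j + 1))).indicator (fun _ => (a j i : ℝ)) x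

/-- The minimal representation of `u`: `0 = t 0 < t 1 < ⋯ < t n = T`, the values `a 0, …, a (n-1)`
belong to `V`, consecutive ones differ, and `u` has the value `a j` between `t j` and
`t (j+1)`. -/
structure IsMinimalRep (V : Finset (Fin M → ℤ)) (u : L1Space T M)
    (n : ℕ) (t : ℕ → ℝ) (a : ℕ → Fin M → ℤ) : Prop where
  t_zero : t 0 = 0
  t_last : t n = T
  t_lt : ∀ j < n, t j < t (j + 1)
  a_mem : ∀ j < n, a j ∈ V
  a_ne : ∀ j, j + 1 < n → a j ≠ a (j + 1)
  ae_eq : ∀ᵐ x ∂(volume.restrict (Ioo (0 : ℝ) T)), ∀ i, u x i = stepFun n t a x i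

/-- The first-order condition: `μ_jᵀ ∇F(u)(t_j) = 0` at every switching point `t_j` of the minimal
representation of `u`, where `μ_j` is the value before minus the value after `t_j`. -/
def FirstOrder (F : L1Space T M → ℝ) (V : Finset (Fin M → ℤ)) (u : L1Space T M) : Prop :=
  ∃ (n : ℕ) (t : ℕ → ℝ) (a : ℕ → Fin M → ℤ), IsMinimalRep V u n t a ∧
    ∀ j, j + 1 < n →
      ∑ i, ((a j i : ℝ) - (a (j + 1) i : ℝ)) * grad F u (t (j + 1)) i = 0

/-- The objective `F + β TV_p`. -/
def objective (p : ℝ≥0∞) (β : ℝ) (F : L1Space T M → ℝ) (u : L1Space T M) : ℝ :=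
  F u + β * (TVp p u).toReal

/-- The objective of the trust-region subproblem `TR(v, g, Δ)`. -/
def trObjective (p : ℝ≥0∞) (β : ℝ) (v : L1Space T M) (g : ℝ → Fin M → ℝ) (u : L1Space T M) : ℝ :=
  (∫ t in Ioo (0 : ℝ) T, ∑ i, g t i * (u t i - v t i))
    + β * (TVp p u).toReal - β * (TVp p v).toReal

/-- `u` solves the trust-region subproblem `TR(v, g, Δ)`. -/
def SolvesTR (p : ℝ≥0∞) (β : ℝ) (V : Finset (Fin M → ℤ)) (v : L1Space T M) (g : ℝ → Fin M → ℝ)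
    (Δ : ℝ) (u : L1Space T M) : Prop :=
  u ∈ Uad T V ∧ ‖u - v‖ ≤ Δ ∧
    ∀ z ∈ Uad T V, ‖z - v‖ ≤ Δ → trObjective p β v g u ≤ trObjective p β v g z

/-- The predicted reduction of the step from `v` to `w`. -/
def pred (p : ℝ≥0∞) (β : ℝ) (F : L1Space T M → ℝ) (v w : L1Space T M) : ℝ :=
  (∫ t in Ioo (0 : ℝ) T, ∑ i, grad F v t i * (v t i - w t i))
    + β * (TVp p v).toReal - β * (TVp p w).toReal

/-- The actual reduction of the step from `v` to `w`. -/
def ared (p : ℝ≥0∞) (β : ℝ) (F : L1Space T M → ℝ) (v w : L1Space T M) : ℝ :=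
  objective p β F v - objective p β F w

/-- The trust-region radius in the inner iteration `k`: it is reset to `Δ₀` at the start of each
outer iteration and halved after each rejected step. -/
def radius (Δ₀ : ℝ) (k : ℕ) : ℝ := Δ₀ / 2 ^ k

/-- An execution of the trust-region algorithm with initial radius `Δ₀` and acceptance parameter
`σ`. The iterates are `u n` for `n ≤ N`, where `N = ⊤` if there are infinitely many. In the
outer iteration with centre `u n`, the inner iteration `k` computes a solution `c n k` of the
subproblem `TR(u n, ∇F(u n), radius Δ₀ k)`. If its predicted reduction is not positive, the
algorithm stops. Otherwise, the step is rejected, and the radius halved, if the actual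
reduction is less than `σ` times the predicted one, and it is accepted as the next iterate if
not. The last inner iteration (if there is one) has the index `κ n`. -/
structure IsTrustRegionRun (p : ℝ≥0∞) (β : ℝ) (V : Finset (Fin M → ℤ)) (F : L1Space T M → ℝ)
    (Δ₀ σ : ℝ) (u : ℕ → L1Space T M) (c : ℕ → ℕ → L1Space T M) (κ : ℕ → ℕ) (N : ℕ∞) : Prop where
  init : u 0 ∈ Uad T V
  /-- An outer iteration that produces a new iterate. -/
  step : ∀ n : ℕ, (n : ℕ∞) < N →
    (∀ k ≤ κ n, SolvesTR p β V (u n) (grad F (u n)) (radius Δ₀ k) (c n k)) ∧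
    (∀ k < κ n, 0 < pred p β F (u n) (c n k) ∧
      ared p β F (u n) (c n k) < σ * pred p β F (u n) (c n k)) ∧
    0 < pred p β F (u n) (c n (κ n)) ∧
    σ * pred p β F (u n) (c n (κ n)) ≤ ared p β F (u n) (c n (κ n)) ∧
    u (n + 1) = c n (κ n)
  /-- The outer iteration at the final iterate: the algorithm stops, or its inner loop is
  infinite. -/
  final : ∀ n : ℕ, N = (n : ℕ∞) →
    ((∀ k ≤ κ n, SolvesTR p β V (u n) (grad F (u n)) (radius Δ₀ k) (c n k)) ∧
      (∀ k < κ n, 0 < pred p β F (u n) (c n k) ∧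
        ared p β F (u n) (c n k) < σ * pred p β F (u n) (c n k)) ∧
      pred p β F (u n) (c n (κ n)) ≤ 0) ∨
    (∀ k, SolvesTR p β V (u n) (grad F (u n)) (radius Δ₀ k) (c n k) ∧
      0 < pred p β F (u n) (c n k) ∧
      ared p β F (u n) (c n k) < σ * pred p β F (u n) (c n k))

/-- Exactly one of three statements is true. -/
def ExactlyOne (A B C : Prop) : Prop :=
  (A ∨ B ∨ C) ∧ ¬(A ∧ B) ∧ ¬(A ∧ C) ∧ ¬(B ∧ C)

end SwitchingControl

end

open SwitchingControl

/-! A function of bounded variation with values in a finite set of integer vectors is a step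
function, and each of its jumps has norm at least one. A bound on TV_p therefore bounds the number
of switches, and a control becomes compact data: finitely many values from V and switching times in
[0,T]. Subsequences with fixed values and convergent times (`exists_subseq_isMinimalRep`) converge
in L^1 and weak-*. In the limit, switching times may merge or reach 0 or T. This is why
representations with degenerate intervals are admitted: for them the sum of the jump norms only
bounds TV_p from above (`IsRep.TVp_le`), with equality if all intervals are nondegenerate
(`IsRep.TVp_eq`).

If v is not first-order stationary, some number μ_jᵀ∇F(v)(t_j) is nonzero, and displacing t_j in the
right direction lowers the linear term at a linear rate in the L^1 distance without increasing TV_p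
(`exists_descent`). The linearisation error is quadratic in that distance (`taylor_estimate`). Hence
small radii at a nonstationary centre lead to acceptance (`accept`), which settles finite runs.

In an infinite run the objective decreases and is bounded below, so the predicted reductions of the
accepted steps tend to zero. If a fixed competitor near an accumulation point v kept predicting a
reduction of at least ρ from the iterates, a radius independent of the iterate would be accepted,
and the accepted step would predict at least ρ too; this is excluded in the limit
(`eventually_model_lt`). The competitor v itself yields convergence of TV_p (`tendsto_toReal_TVp`),
and then v with one switch displaced yields stationarity (`limit_firstOrder`).

That TV_p is not lost in the limit means that merging jumps satisfy equality in the triangle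
inequality. For 1 < p < ∞ such jumps are positive multiples of each other, so no other norm loses
anything either (`IsRep.TVp_eq_of_eq`). -/

noncomputable section

namespace SwitchingControl

/-! ### Vector norms: duality and strict convexity -/

section

variable {M : ℕ}

theorem pNorm_top (x : Fin M → ℝ) : pNorm ⊤ x = ‖x‖ := by
  rw [pNorm, PiLp.norm_toLp]

theorem pNorm_one (x : Fin M → ℝ) : pNorm 1 x = ∑ i, |x i| := by
  rw [pNorm, PiLp.norm_eq_of_L1]; simp

theorem pNorm_real {p : ℝ} (hp : 0 < p) (x : Fin M → ℝ) :
    pNorm (ENNReal.ofReal p) x = (∑ i, |x i| ^ p) ^ (1 / p) := by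
  rw [pNorm, PiLp.norm_eq_sum (by simpa [ENNReal.toReal_ofReal hp.le] using hp)]
  simp [ENNReal.toReal_ofReal hp.le]

section
variable {p : ℝ≥0∞} (hp : 1 ≤ p)
include hp

theorem pNorm_nonneg (x : Fin M → ℝ) : 0 ≤ pNorm p x := by
  have := Fact.mk hp; exact norm_nonneg _

theorem pNorm_zero : pNorm p (0 : Fin M → ℝ) = 0 := by
  have := Fact.mk hp; simp [pNorm]

theorem pNorm_add_le (x y : Fin M → ℝ) : pNorm p (x + y) ≤ pNorm p x + pNorm p y := by
  have := Fact.mk hp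
  simpa [pNorm] using norm_add_le (WithLp.toLp p x) (WithLp.toLp p y)

theorem pNorm_smul (c : ℝ) (x : Fin M → ℝ) : pNorm p (c • x) = |c| * pNorm p x := by
  have := Fact.mk hp
  simpa [pNorm] using norm_smul c (WithLp.toLp p x)

theorem pNorm_neg (x : Fin M → ℝ) : pNorm p (-x) = pNorm p x := by
  have := pNorm_smul hp (-1) x; simpa using this

theorem pNorm_sum_le {ι : Type*} (s : Finset ι) (f : ι → Fin M → ℝ) :
    pNorm p (∑ i ∈ s, f i) ≤ ∑ i ∈ s, pNorm p (f i) := by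
  classical
  induction s using Finset.induction_on with
  | empty => simp [pNorm_zero hp]
  | insert a s ha ih =>
    rw [Finset.sum_insert ha, Finset.sum_insert ha]
    linarith [pNorm_add_le hp (f a) (∑ i ∈ s, f i)]

theorem abs_apply_le_pNorm (x : Fin M → ℝ) (i : Fin M) : |x i| ≤ pNorm p x := by
  have := Fact.mk hp
  exact PiLp.norm_apply_le (WithLp.toLp p x) i

theorem edist_toLp (x y : Fin M → ℝ) :
    haveI := Fact.mk hp
    edist (WithLp.toLp p x : PiLp p fun _ : Fin M => ℝ) (WithLp.toLp p y)
      = ENNReal.ofReal (pNorm p (x - y)) := by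
  have := Fact.mk hp
  rw [edist_dist, dist_eq_norm, ← WithLp.toLp_sub]; rfl

theorem one_le_pNorm_of_int {x : Fin M → ℤ} (hx : x ≠ 0) :
    1 ≤ pNorm p (fun i => (x i : ℝ)) := by
  obtain ⟨i, hi⟩ := Function.ne_iff.1 hx
  refine le_trans ?_ (abs_apply_le_pNorm hp _ i)
  have : 1 ≤ |x i| := Int.one_le_abs hi
  exact_mod_cast this

end

theorem one_le_conjExponent (p : ℝ≥0∞) : 1 ≤ p.conjExponent := by
  simp [ENNReal.conjExponent]

/-- An extended exponent `p ≥ 1` is `1`, `∞` or a real number `> 1`. -/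
theorem exponent_cases {p : ℝ≥0∞} (hp : 1 ≤ p) :
    (p = 1 ∧ p.conjExponent = ⊤) ∨ (p = ⊤ ∧ p.conjExponent = 1) ∨
    ∃ r s : ℝ, r.HolderConjugate s ∧ p = ENNReal.ofReal r ∧ p.conjExponent = ENNReal.ofReal s := by
  rcases eq_or_lt_of_le hp with rfl | h1
  · left; simp [ENNReal.conjExponent]
  rcases eq_or_ne p ⊤ with rfl | h2
  · right; left; simp [ENNReal.conjExponent]
  · right; right
    lift p to NNReal using h2
    have h1' : 1 < p := by exact_mod_cast h1
    refine ⟨p, NNReal.conjExponent p, ?_, by simp, ?_⟩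
    · exact_mod_cast NNReal.HolderConjugate.conjExponent h1'
    · rw [← ENNReal.coe_conjExponent h1']; simp

theorem sum_mul_le_pNorm_mul {p : ℝ≥0∞} (hp : 1 ≤ p) (x y : Fin M → ℝ) :
    ∑ i, x i * y i ≤ pNorm p x * pNorm p.conjExponent y := by
  rcases exponent_cases hp with ⟨h, h'⟩ | ⟨h, h'⟩ | ⟨r, s, hrs, h, h'⟩
  · rw [h', h, pNorm_one, pNorm_top, Finset.sum_mul]
    refine Finset.sum_le_sum fun i _ => (le_abs_self _).trans ?_
    rw [abs_mul]
    exact mul_le_mul_of_nonneg_left (norm_le_pi_norm y i) (abs_nonneg _)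
  · rw [h', h, pNorm_one, pNorm_top, Finset.mul_sum]
    refine Finset.sum_le_sum fun i _ => (le_abs_self _).trans ?_
    rw [abs_mul]
    exact mul_le_mul_of_nonneg_right (norm_le_pi_norm x i) (abs_nonneg _)
  · rw [h', h, pNorm_real hrs.pos, pNorm_real hrs.symm.pos]
    exact Real.inner_le_Lp_mul_Lq _ _ _ hrs

/-- The `p`-norm of a vector is attained by the pairing with a vector of dual norm at most `1`. -/
theorem exists_dual {p : ℝ≥0∞} (hp : 1 ≤ p) (x : Fin M → ℝ) :
    ∃ y : Fin M → ℝ, pNorm p.conjExponent y ≤ 1 ∧ ∑ i, x i * y i = pNorm p x := by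
  have hsgn : ∀ i, |(SignType.sign (x i) : ℝ)| ≤ 1 := fun i => by
    rcases lt_trichotomy (x i) 0 with h | h | h <;> simp [h]
  rcases exponent_cases hp with ⟨h, h'⟩ | ⟨h, h'⟩ | ⟨r, s, hrs, h, h'⟩
  · refine ⟨fun i => SignType.sign (x i), ?_, ?_⟩
    · rw [h', pNorm_top]
      exact (pi_norm_le_iff_of_nonneg zero_le_one).2 hsgn
    · rw [h, pNorm_one]
      exact Finset.sum_congr rfl fun i _ => by rw [mul_comm, sign_mul_self]
  · rw [h', h, pNorm_top]
    rcases isEmpty_or_nonempty (Fin M) with hM | hM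
    · exact ⟨0, by simp [pNorm_zero le_rfl], by simp [Subsingleton.elim x 0]⟩
    · obtain ⟨i, hi⟩ : ∃ i, ‖x i‖ = ‖x‖ := by
        obtain ⟨i, -, hi⟩ := Finset.exists_mem_eq_sup Finset.univ Finset.univ_nonempty fun i => ‖x i‖₊
        exact ⟨i, by rw [Pi.norm_def, hi]; rfl⟩
      refine ⟨Pi.single i (SignType.sign (x i) : ℝ), ?_, ?_⟩
      · rw [pNorm_one, Finset.sum_eq_single i]
        · simpa using hsgn i
        · intro j _ hj; simp [hj]
        · simp
      · rw [Finset.sum_eq_single i]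
        · rw [Pi.single_eq_same, mul_comm, sign_mul_self, ← hi]; rfl
        · intro j _ hj; simp [hj]
        · simp
  · rw [h', h, pNorm_real hrs.pos]
    -- The extremal vector for the absolute values of x, equipped with the signs of x, is extremal
    -- for x.
    obtain ⟨⟨g, hg, hg'⟩, -⟩ := NNReal.isGreatest_Lp Finset.univ (fun i => ‖x i‖₊) hrs
    refine ⟨fun i => SignType.sign (x i) * g i, ?_, ?_⟩
    · rw [pNorm_real hrs.symm.pos]
      refine Real.rpow_le_one (by positivity) ?_ (by have := hrs.symm.pos; positivity)
      have hg1 : ∑ i, (g i : ℝ) ^ s ≤ 1 := by exact_mod_cast hg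
      refine le_trans (Finset.sum_le_sum fun i _ => ?_) hg1
      refine Real.rpow_le_rpow (abs_nonneg _) ?_ hrs.symm.nonneg
      rw [abs_mul, abs_of_nonneg (NNReal.coe_nonneg (g i))]
      exact mul_le_of_le_one_left (g i).2 (hsgn i)
    · have := congrArg (fun z : NNReal => (z : ℝ)) hg'
      push_cast at this
      simp only [Real.norm_eq_abs] at this
      rw [← this]
      exact Finset.sum_congr rfl fun i _ => by
        rw [← mul_assoc, mul_comm (x i), sign_mul_self]

/-- If |x| ≠ |y|, this is strict convexity of the power on the half-line. If |x| = |y|, then y = -x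
is nonzero, and the strictness comes from cancellation inside the absolute value. -/
theorem abs_combo_rpow_lt {r : ℝ} (hr : 1 < r) {x y l m : ℝ} (hxy : x ≠ y) (hl : 0 < l) (hm : 0 < m)
    (hlm : l + m = 1) : |l * x + m * y| ^ r < l * |x| ^ r + m * |y| ^ r := by
  have hle : |l * x + m * y| ≤ l * |x| + m * |y| := by
    refine (abs_add_le _ _).trans (by rw [abs_mul, abs_mul, abs_of_pos hl, abs_of_pos hm])
  by_cases h : |x| = |y|
  · have hx : y = -x := by
      rcases abs_eq_abs.1 h with h | h
      · exact absurd h hxy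
      · rw [h]; ring
    have hx0 : 0 < |x| := abs_pos.2 fun h0 => hxy (by rw [hx, h0]; simp)
    have : |l * x + m * y| < |x| := by
      rw [hx, show l * x + m * -x = (l - m) * x by ring, abs_mul]
      refine mul_lt_of_lt_one_left hx0 (abs_lt.2 ⟨?_, ?_⟩) <;> linarith
    rw [← h, ← add_mul, hlm, one_mul]
    exact Real.rpow_lt_rpow (abs_nonneg _) this (by linarith)
  · have := (strictConvexOn_rpow hr).2 (abs_nonneg x : |x| ∈ Ici (0:ℝ)) (abs_nonneg y : |y| ∈ Ici (0:ℝ)) h hl hm hlm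
    simp only [smul_eq_mul] at this
    exact lt_of_le_of_lt (Real.rpow_le_rpow (abs_nonneg _) hle (by linarith)) this

/-- By strict convexity, equality in the triangle inequality for one `p`-norm with `1 < p < ∞`
implies equality for all of them. -/
theorem pNorm_add_eq_of_eq {p q : ℝ≥0∞} (hp : 1 < p) (hp' : p < ⊤) (hq : 1 ≤ q)
    {x y : Fin M → ℝ} (h : pNorm p (x + y) = pNorm p x + pNorm p y) :
    pNorm q (x + y) = pNorm q x + pNorm q y := by
  have hp1 := hp.le
  obtain ⟨r, hr, rfl⟩ : ∃ r : ℝ, 1 < r ∧ p = ENNReal.ofReal r := by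
    lift p to NNReal using hp'.ne
    exact ⟨p, by exact_mod_cast hp, by simp⟩
  have hr0 : 0 < r := by linarith
  have hz : ∀ z : Fin M → ℝ, pNorm (ENNReal.ofReal r) z = 0 → z = 0 := fun z hz => by
    ext i
    have := abs_apply_le_pNorm hp1 z i
    rw [hz] at this
    simpa using this
  set a := pNorm (ENNReal.ofReal r) x with ha
  set b := pNorm (ENNReal.ofReal r) y with hb
  rcases (pNorm_nonneg hp1 x).eq_or_lt with h0 | ha0
  · rw [hz x h0.symm]; simp [pNorm_zero hq]
  rcases (pNorm_nonneg hp1 y).eq_or_lt with h0 | hb0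
  · rw [hz y h0.symm]; simp [pNorm_zero hq]
  rw [← ha] at ha0
  rw [← hb] at hb0
  have hsum : ∀ z : Fin M → ℝ, ∑ i, |z i| ^ r = pNorm (ENNReal.ofReal r) z ^ r := fun z => by
    rw [pNorm_real hr0, ← Real.rpow_mul (by positivity)]
    rw [one_div_mul_cancel hr0.ne', Real.rpow_one]
  -- The normalised vectors x/a and y/b have norm one, and by hypothesis so has their convex
  -- combination (x + y)/(a + b). If they differed in one component, strict convexity would push the
  -- sum of r-th powers of the combination below one.
  have key : ∀ i, a⁻¹ * x i = b⁻¹ * y i := by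
    by_contra! hne
    obtain ⟨i, hi⟩ := hne
    have hl : 0 < a / (a + b) := by positivity
    have hm : 0 < b / (a + b) := by positivity
    have hlm : a / (a + b) + b / (a + b) = 1 := by field_simp
    have hlt : ∑ i, |a / (a + b) * (a⁻¹ * x i) + b / (a + b) * (b⁻¹ * y i)| ^ r <
        ∑ i, (a / (a + b) * |a⁻¹ * x i| ^ r + b / (a + b) * |b⁻¹ * y i| ^ r) := by
      refine Finset.sum_lt_sum (fun j _ => ?_) ⟨i, Finset.mem_univ _, abs_combo_rpow_lt hr hi hl hm hlm⟩
      by_cases hj : a⁻¹ * x j = b⁻¹ * y j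
      · rw [hj, ← add_mul, ← add_mul, hlm, one_mul, one_mul]
      · exact (abs_combo_rpow_lt hr hj hl hm hlm).le
    have e1 : ∀ i, a / (a + b) * (a⁻¹ * x i) + b / (a + b) * (b⁻¹ * y i)
        = ((a + b)⁻¹ • (x + y)) i := fun i => by
      simp only [Pi.smul_apply, Pi.add_apply, smul_eq_mul]; field_simp
    simp_rw [e1] at hlt
    rw [hsum, pNorm_smul hp1, h, Finset.sum_add_distrib, ← Finset.mul_sum, ← Finset.mul_sum] at hlt
    have e2 : ∑ i, |a⁻¹ * x i| ^ r = 1 := by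
      have := hsum (a⁻¹ • x)
      simp only [Pi.smul_apply, smul_eq_mul] at this
      rw [this, pNorm_smul hp1, ← ha, abs_of_pos (inv_pos.2 ha0), inv_mul_cancel₀ ha0.ne', Real.one_rpow]
    have e3 : ∑ i, |b⁻¹ * y i| ^ r = 1 := by
      have := hsum (b⁻¹ • y)
      simp only [Pi.smul_apply, smul_eq_mul] at this
      rw [this, pNorm_smul hp1, ← hb, abs_of_pos (inv_pos.2 hb0), inv_mul_cancel₀ hb0.ne', Real.one_rpow]
    rw [e2, e3, mul_one, mul_one, hlm, abs_of_pos (by positivity), inv_mul_cancel₀ (by positivity),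
      Real.one_rpow] at hlt
    exact lt_irrefl _ hlt
  have hy : y = (b / a) • x := by
    ext i
    have := key i
    simp only [Pi.smul_apply, smul_eq_mul]
    field_simp at this ⊢
    linarith
  have : x + y = (1 + b / a) • x := by rw [hy, add_smul, one_smul]
  rw [this, hy, pNorm_smul hq, pNorm_smul hq, abs_of_pos (by positivity), abs_of_pos (by positivity)]
  ring

end

/-! ### Total variation on L^1: lower semicontinuity and lower bounds by jumps -/

section

variable {T : ℝ} {M : ℕ}

theorem integrable_apply (u : L1Space T M) (i : Fin M) :
    Integrable (fun t => u t i) (volume.restrict (Ioo (0 : ℝ) T)) :=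
  ContinuousLinearMap.integrable_comp (PiLp.proj (𝕜 := ℝ) 1 (fun _ : Fin M => ℝ) i)
    (L1.integrable_coeFn u)

theorem integrable_pairing {h : ℝ → Fin M → ℝ}
    (hm : AEStronglyMeasurable h (volume.restrict (Ioo (0 : ℝ) T))) {B : ℝ}
    (hB : ∀ᵐ t ∂(volume.restrict (Ioo (0 : ℝ) T)), ‖h t‖ ≤ B) (u : L1Space T M) :
    Integrable (fun t => ∑ i, h t i * u t i) (volume.restrict (Ioo (0 : ℝ) T)) := by
  refine integrable_finsetSum _ fun i _ => ?_
  refine (integrable_apply u i).bdd_mul (c := B) ?_ ?_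
  · exact (continuous_apply i).comp_aestronglyMeasurable hm
  · filter_upwards [hB] with t ht using (norm_le_pi_norm (h t) i).trans ht

theorem coeFn_sub_apply (u v : L1Space T M) :
    ∀ᵐ t ∂(volume.restrict (Ioo (0 : ℝ) T)), ∀ i, (u - v) t i = u t i - v t i := by
  filter_upwards [Lp.coeFn_sub u v] with t ht i
  rw [ht]; rfl

theorem pairing_sub {h : ℝ → Fin M → ℝ}
    (hm : AEStronglyMeasurable h (volume.restrict (Ioo (0 : ℝ) T))) {B : ℝ}
    (hB : ∀ᵐ t ∂(volume.restrict (Ioo (0 : ℝ) T)), ‖h t‖ ≤ B) (u v : L1Space T M) :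
    ∫ t in Ioo (0 : ℝ) T, ∑ i, h t i * (u - v) t i =
      (∫ t in Ioo (0 : ℝ) T, ∑ i, h t i * u t i) - ∫ t in Ioo (0 : ℝ) T, ∑ i, h t i * v t i := by
  rw [← integral_sub (integrable_pairing hm hB u) (integrable_pairing hm hB v)]
  refine integral_congr_ae ?_
  filter_upwards [coeFn_sub_apply u v] with t ht
  rw [← Finset.sum_sub_distrib]
  exact Finset.sum_congr rfl fun i _ => by rw [ht i]; ring

theorem norm_eq_integral (u : L1Space T M) :
    ‖u‖ = ∫ t in Ioo (0 : ℝ) T, ∑ i, |u t i| := by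
  rw [L1.norm_eq_integral_norm]
  refine integral_congr_ae (Eventually.of_forall fun t => ?_)
  simp [PiLp.norm_eq_of_L1]

theorem abs_pairing_le {h : ℝ → Fin M → ℝ} {B : ℝ}
    (hB : ∀ᵐ t ∂(volume.restrict (Ioo (0 : ℝ) T)), ‖h t‖ ≤ B) (u : L1Space T M) :
    |∫ t in Ioo (0 : ℝ) T, ∑ i, h t i * u t i| ≤ B * ‖u‖ := by
  rw [norm_eq_integral, ← integral_const_mul, ← Real.norm_eq_abs]
  refine norm_integral_le_of_norm_le ?_ ?_
  · exact (integrable_finsetSum _ fun i _ => (integrable_apply u i).abs).const_mul B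
  · filter_upwards [hB] with t ht
    rw [Finset.mul_sum]
    refine (norm_sum_le _ _).trans (Finset.sum_le_sum fun i _ => ?_)
    rw [norm_mul]
    exact mul_le_mul_of_nonneg_right ((norm_le_pi_norm (h t) i).trans ht) (abs_nonneg _)

theorem continuous_pairing {h : ℝ → Fin M → ℝ}
    (hm : AEStronglyMeasurable h (volume.restrict (Ioo (0 : ℝ) T))) {B : ℝ}
    (hB : ∀ᵐ t ∂(volume.restrict (Ioo (0 : ℝ) T)), ‖h t‖ ≤ B) :
    Continuous fun u : L1Space T M => ∫ t in Ioo (0 : ℝ) T, ∑ i, h t i * u t i := by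
  refine continuous_iff_continuousAt.2 fun v => ?_
  refine tendsto_iff_norm_sub_tendsto_zero.2 ?_
  have h0 : Tendsto (fun u : L1Space T M => B * ‖u - v‖) (𝓝 v) (𝓝 0) := by
    have : Continuous fun u : L1Space T M => B * ‖u - v‖ := by fun_prop
    simpa using this.tendsto v
  refine squeeze_zero (fun _ => norm_nonneg _) (fun u => ?_) h0
  rw [← pairing_sub hm hB]
  exact abs_pairing_le hB _

theorem exists_bound_deriv {φ : ℝ → Fin M → ℝ} (h1 : ContDiff ℝ 1 φ) (h2 : HasCompactSupport φ) :
    ∃ B, ∀ t, ‖deriv φ t‖ ≤ B :=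
  (h1.continuous_deriv le_rfl).bounded_above_of_compact_support h2.deriv

/-- A supremum of functionals that are continuous on L^1, since the derivative of a test function is
bounded. -/
theorem lowerSemicontinuous_TVp (p : ℝ≥0∞) : LowerSemicontinuous (TVp p : L1Space T M → ℝ≥0∞) := by
  refine lowerSemicontinuous_biSup fun φ hφ => Continuous.lowerSemicontinuous ?_
  obtain ⟨B, hB⟩ := exists_bound_deriv hφ.1 hφ.2.1
  refine ENNReal.continuous_ofReal.comp ?_
  simp_rw [mul_comm _ (deriv φ _ _)]
  exact continuous_pairing (hφ.1.continuous_deriv le_rfl).aestronglyMeasurable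
    (Eventually.of_forall hB)

/-- A smooth monotone transition from `0` to `1` on `[-r, r]`. -/
def ramp (ρ : ContDiffBump (0 : ℝ)) (x : ℝ) : ℝ := ∫ t in Iic x, ρ.normed volume t

theorem hasDerivAt_ramp (ρ : ContDiffBump (0 : ℝ)) (x : ℝ) :
    HasDerivAt (ramp ρ) (ρ.normed volume x) x := by
  have hi : Integrable (ρ.normed volume) volume := ρ.integrable_normed
  have h : ramp ρ = fun y => (∫ t in Iic x, ρ.normed volume t) + ∫ t in x..y, ρ.normed volume t := by
    ext y
    rw [intervalIntegral.integral_Iic_sub_Iic hi.integrableOn hi.integrableOn |>.symm, ramp]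
    ring
  rw [h]
  refine HasDerivAt.const_add _ ?_
  exact intervalIntegral.integral_hasDerivAt_right (hi.intervalIntegrable)
    (ρ.continuous_normed.stronglyMeasurableAtFilter _ _) ρ.continuous_normed.continuousAt

theorem ramp_mono (ρ : ContDiffBump (0 : ℝ)) : Monotone (ramp ρ) := fun _ _ hxy =>
  setIntegral_mono_set ρ.integrable_normed.integrableOn
    (Eventually.of_forall fun t => ρ.nonneg_normed t) (Iic_subset_Iic.2 hxy).eventuallyLE

theorem ramp_nonneg (ρ : ContDiffBump (0 : ℝ)) (x : ℝ) : 0 ≤ ramp ρ x :=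
  integral_nonneg fun t => ρ.nonneg_normed t

theorem ramp_eq_zero (ρ : ContDiffBump (0 : ℝ)) {x : ℝ} (hx : x ≤ -ρ.rOut) : ramp ρ x = 0 := by
  refine setIntegral_eq_zero_of_forall_eq_zero fun t ht => ?_
  have : t ∉ Function.support (ρ.normed volume) := by
    rw [ρ.support_normed_eq, Metric.mem_ball, dist_zero_right, Real.norm_eq_abs]
    have : t ≤ x := ht
    exact not_lt.2 ((by linarith : ρ.rOut ≤ -t).trans (neg_le_abs t))
  simpa using this

theorem ramp_eq_one (ρ : ContDiffBump (0 : ℝ)) {x : ℝ} (hx : ρ.rOut ≤ x) : ramp ρ x = 1 := by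
  rw [← ρ.integral_normed (μ := volume), ramp]
  refine setIntegral_eq_integral_of_forall_compl_eq_zero fun t ht => ?_
  have : t ∉ Function.support (ρ.normed volume) := by
    rw [ρ.support_normed_eq, Metric.mem_ball, dist_zero_right, Real.norm_eq_abs]
    have : x < t := not_le.1 ht
    exact not_lt.2 ((by linarith : ρ.rOut ≤ t).trans (le_abs_self t))
  simpa using this

theorem ramp_le_one (ρ : ContDiffBump (0 : ℝ)) (x : ℝ) : ramp ρ x ≤ 1 := by
  rw [← ramp_eq_one ρ (le_max_right x ρ.rOut)]
  exact ramp_mono ρ (le_max_left _ _)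

/-- The test function that has the value `- y j` between the points `s j` and `s (j+1)`, up to
smooth transitions. -/
def chainTest (ρ : ContDiffBump (0 : ℝ)) (k : ℕ) (s : ℕ → ℝ) (y : ℕ → Fin M → ℝ) (x : ℝ) :
    Fin M → ℝ :=
  ∑ j ∈ Finset.range k, (ramp ρ (x - s (j + 1)) - ramp ρ (x - s j)) • y j

theorem hasDerivAt_chainTest (ρ : ContDiffBump (0 : ℝ)) (k : ℕ) (s : ℕ → ℝ) (y : ℕ → Fin M → ℝ)
    (x : ℝ) : HasDerivAt (chainTest ρ k s y)
      (∑ j ∈ Finset.range k,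
        (ρ.normed volume (x - s (j + 1)) - ρ.normed volume (x - s j)) • y j) x := by
  unfold chainTest
  refine HasDerivAt.fun_sum fun j _ => ?_
  refine HasDerivAt.smul_const ?_ (y j)
  exact ((hasDerivAt_ramp ρ _).comp_sub_const x _).sub ((hasDerivAt_ramp ρ _).comp_sub_const x _)

/-- The transitions may overlap without harm: since `ramp` is monotone, the coefficients of the
vectors `-y j` are nonnegative, and their sum telescopes to at most one. -/
theorem chainTest_mem {p : ℝ≥0∞} (ρ : ContDiffBump (0 : ℝ)) (k : ℕ) {s : ℕ → ℝ} (hs : Monotone s)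
    {y : ℕ → Fin M → ℝ} (hy : ∀ j, pNorm p.conjExponent (y j) ≤ 1)
    (h0 : ρ.rOut < s 0) (hT : s k + ρ.rOut < T) : chainTest ρ k s y ∈ tvTests T M p := by
  have hsupp : Function.support (chainTest ρ k s y) ⊆ Icc (s 0 - ρ.rOut) (s k + ρ.rOut) := by
    intro x hx
    by_contra hx'
    refine hx (Finset.sum_eq_zero fun j hj => ?_)
    have hj' : j + 1 ≤ k := Finset.mem_range.1 hj
    have h1 := hs (Nat.zero_le j)
    have h2 := hs (Nat.le_succ j)
    have h3 := hs hj'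
    have : ramp ρ (x - s (j + 1)) = ramp ρ (x - s j) := by
      rcases not_and_or.1 hx' with h | h
      · rw [ramp_eq_zero ρ, ramp_eq_zero ρ] <;> simp only [Nat.succ_eq_add_one] at * <;> linarith
      · rw [ramp_eq_one ρ, ramp_eq_one ρ] <;> simp only [Nat.succ_eq_add_one] at * <;> linarith
    rw [this, sub_self, zero_smul]
  refine ⟨?_, ?_, ?_, fun x => ?_⟩
  · refine contDiff_one_iff_deriv.2 ⟨fun x => (hasDerivAt_chainTest ρ k s y x).differentiableAt, ?_⟩
    rw [funext fun x => (hasDerivAt_chainTest ρ k s y x).deriv]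
    have := ρ.continuous_normed (μ := volume)
    fun_prop
  · exact HasCompactSupport.of_support_subset_isCompact isCompact_Icc hsupp
  · refine (closure_minimal hsupp isClosed_Icc).trans ?_
    exact Icc_subset_Ioo (by linarith) hT
  · have hq := one_le_conjExponent p
    calc pNorm p.conjExponent (chainTest ρ k s y x)
        ≤ ∑ j ∈ Finset.range k, pNorm p.conjExponent
            ((ramp ρ (x - s (j + 1)) - ramp ρ (x - s j)) • y j) := pNorm_sum_le hq _ _
      _ ≤ ∑ j ∈ Finset.range k, (ramp ρ (x - s j) - ramp ρ (x - s (j + 1))) := by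
          refine Finset.sum_le_sum fun j _ => ?_
          have : ramp ρ (x - s (j + 1)) ≤ ramp ρ (x - s j) :=
            ramp_mono ρ (by have := hs (Nat.le_succ j); simp only [Nat.succ_eq_add_one] at this; linarith)
          rw [pNorm_smul hq, abs_of_nonpos (by linarith), neg_sub]
          exact mul_le_of_le_one_right (by linarith) (hy j)
      _ = ramp ρ (x - s 0) - ramp ρ (x - s k) := Finset.sum_range_sub' (fun j => ramp ρ (x - s j)) k
      _ ≤ 1 := by linarith [ramp_le_one ρ (x - s 0), ramp_nonneg ρ (x - s k)]

/-- A sequence of bump functions whose supports shrink to a point. -/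
def shrinkingBump (m : ℕ) : ContDiffBump (0 : ℝ) where
  rIn := 1 / (m + 1)
  rOut := 2 * (1 / (m + 1))
  rIn_pos := by positivity
  rIn_lt_rOut := by have : (0 : ℝ) < 1 / (m + 1) := by positivity
                    linarith

theorem tendsto_shrinkingBump : Tendsto (fun m => (shrinkingBump m).rOut) atTop (𝓝 0) := by
  have := (tendsto_one_div_add_atTop_nhds_zero_nat (𝕜 := ℝ)).const_mul 2
  simpa [shrinkingBump] using this

/-- The points at which the mollifications of `u` converge to `u`. -/
def mollPoints (u : L1Space T M) : Set ℝ :=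
  {x | x ∈ Ioo 0 T ∧ ∀ i, Tendsto (fun m =>
    ∫ t in Ioo (0 : ℝ) T, (shrinkingBump m).normed volume (t - x) * u t i) atTop (𝓝 (u x i))}

theorem ae_mem_mollPoints (u : L1Space T M) :
    ∀ᵐ x ∂(volume.restrict (Ioo (0 : ℝ) T)), x ∈ mollPoints u := by
  have key : ∀ i, ∀ᵐ x ∂(volume : Measure ℝ), Tendsto (fun m =>
      convolution ((shrinkingBump m).normed volume) ((Ioo 0 T).indicator fun t => u t i)
        (ContinuousLinearMap.lsmul ℝ ℝ) volume x) atTop (𝓝 ((Ioo 0 T).indicator (fun t => u t i) x)) := by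
    intro i
    -- Lebesgue differentiation for bump functions needs a bounded ratio of outer to inner radius;
    -- here it is always 2.
    refine ContDiffBump.ae_convolution_tendsto_right_of_locallyIntegrable (K := 2)
      tendsto_shrinkingBump (Eventually.of_forall fun m => le_rfl) ?_
    exact (IntegrableOn.integrable_indicator (integrable_apply u i) measurableSet_Ioo).locallyIntegrable
  rw [ae_restrict_iff' measurableSet_Ioo]
  filter_upwards [ae_all_iff.2 key] with x hx hxT
  refine ⟨hxT, fun i => ?_⟩
  have := hx i
  rw [indicator_of_mem hxT] at this
  refine this.congr fun m => ?_
  rw [convolution_eq_swap, ← integral_indicator measurableSet_Ioo]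
  refine integral_congr_ae (Eventually.of_forall fun t => ?_)
  simp only [ContinuousLinearMap.lsmul_apply, smul_eq_mul]
  rw [← (shrinkingBump m).normed_neg (x - t), neg_sub]
  by_cases ht : t ∈ Ioo 0 T <;> simp [ht]

/-- The derivative of the chain test function is a combination of bumps at the points `s j`. With
each `y j` dual to the corresponding increment of u, its pairing with u tends to the sum of the
increment norms as the bumps shrink. -/
theorem sum_jumps_le_TVp {p : ℝ≥0∞} (hp : 1 ≤ p) (u : L1Space T M) (k : ℕ) {s : ℕ → ℝ}
    (hs : Monotone s) (hsu : ∀ j, s j ∈ mollPoints u) :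
    ENNReal.ofReal (∑ j ∈ Finset.range k, pNorm p (fun i => u (s (j + 1)) i - u (s j) i))
      ≤ TVp p u := by
  choose y hy hxy using fun j => exists_dual hp (fun i => u (s (j + 1)) i - u (s j) i)
  have hint : ∀ m i x, Integrable (fun t => (shrinkingBump m).normed volume (t - x) * u t i)
      (volume.restrict (Ioo (0 : ℝ) T)) := fun m i x => by
    obtain ⟨B, hB⟩ := ((shrinkingBump m).continuous_normed (μ := volume)).bounded_above_of_compact_support
      (shrinkingBump m).hasCompactSupport_normed
    refine (integrable_apply u i).bdd_mul (c := B) ?_ (Eventually.of_forall fun t => hB _)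
    have := (shrinkingBump m).continuous_normed (μ := volume)
    exact (by fun_prop : Continuous fun t => (shrinkingBump m).normed volume (t - x)).aestronglyMeasurable
  have hval : ∀ m, ∫ t in Ioo (0 : ℝ) T, ∑ i, u t i * deriv (chainTest (shrinkingBump m) k s y) t i
      = ∑ j ∈ Finset.range k, ∑ i,
        ((∫ t in Ioo (0 : ℝ) T, (shrinkingBump m).normed volume (t - s (j + 1)) * u t i)
          - ∫ t in Ioo (0 : ℝ) T, (shrinkingBump m).normed volume (t - s j) * u t i) * y j i := by
    intro m
    simp_rw [← integral_sub (hint m _ _) (hint m _ _), ← integral_mul_const]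
    have hint' : ∀ j i, Integrable (fun t => ((shrinkingBump m).normed volume (t - s (j + 1)) * u t i
        - (shrinkingBump m).normed volume (t - s j) * u t i) * y j i)
        (volume.restrict (Ioo (0 : ℝ) T)) := fun j i => ((hint m _ _).sub (hint m _ _)).mul_const _
    simp_rw [← integral_finsetSum _ fun i _ => hint' _ i]
    rw [← integral_finsetSum _ fun j _ => integrable_finsetSum _ fun i _ => hint' j i]
    refine integral_congr_ae (Eventually.of_forall fun t => ?_)
    simp only [(hasDerivAt_chainTest _ k s y t).deriv, Finset.sum_apply, Pi.smul_apply, smul_eq_mul,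
      Finset.mul_sum]
    rw [Finset.sum_comm]
    refine Finset.sum_congr rfl fun j _ => Finset.sum_congr rfl fun i _ => by ring
  have hlim : Tendsto (fun m => ∫ t in Ioo (0 : ℝ) T,
      ∑ i, u t i * deriv (chainTest (shrinkingBump m) k s y) t i) atTop
      (𝓝 (∑ j ∈ Finset.range k, pNorm p (fun i => u (s (j + 1)) i - u (s j) i))) := by
    simp_rw [hval, ← hxy]
    refine tendsto_finsetSum _ fun j _ => tendsto_finsetSum _ fun i _ => ?_
    exact (((hsu (j + 1)).2 i).sub ((hsu j).2 i)).mul_const _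
  refine le_of_tendsto ((ENNReal.continuous_ofReal.tendsto _).comp hlim) ?_
  have e1 : ∀ᶠ m in atTop, (shrinkingBump m).rOut < s 0 :=
    tendsto_shrinkingBump.eventually_lt_const (hsu 0).1.1
  have e2 : ∀ᶠ m in atTop, (shrinkingBump m).rOut < T - s k :=
    tendsto_shrinkingBump.eventually_lt_const (sub_pos.2 (hsu k).1.2)
  filter_upwards [e1, e2] with m h1 h2
  exact le_iSup₂_of_le (chainTest (shrinkingBump m) k s y)
    (chainTest_mem _ k hs hy h1 (by linarith)) le_rfl

end

/-! ### Step functions and their representations -/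

section

variable {T : ℝ} {M : ℕ}

/-- A representation of `u` by a weakly increasing partition: intervals may be degenerate and
consecutive values may coincide. -/
structure IsRep (V : Finset (Fin M → ℤ)) (u : L1Space T M)
    (n : ℕ) (t : ℕ → ℝ) (a : ℕ → Fin M → ℤ) : Prop where
  t_zero : t 0 = 0
  t_last : t n = T
  t_le : ∀ j < n, t j ≤ t (j + 1)
  a_mem : ∀ j < n, a j ∈ V
  ae_eq : ∀ᵐ x ∂(volume.restrict (Ioo (0 : ℝ) T)), ∀ j < n, x ∈ Ioo (t j) (t (j + 1)) →
    ∀ i, u x i = a j i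

/-- The jump of a step function between its values `a j` and `a (j+1)`. -/
def jump (a : ℕ → Fin M → ℤ) (j : ℕ) : Fin M → ℝ := fun i => (a (j + 1) i : ℝ) - a j i

theorem mono_of_le_succ {n : ℕ} {t : ℕ → ℝ} (h : ∀ j < n, t j ≤ t (j + 1)) {i j : ℕ} (hij : i ≤ j)
    (hj : j ≤ n) : t i ≤ t j := by
  induction j, hij using Nat.le_induction with
  | base => exact le_rfl
  | succ k _ ih => exact (ih (by omega)).trans (h k (by omega))

theorem exists_mem_Ioo_of_partition {n : ℕ} {t : ℕ → ℝ} {x : ℝ} (h0 : t 0 ≤ x) (hn : x < t n)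
    (hx : ∀ j, x ≠ t j) : ∃ j < n, x ∈ Ioo (t j) (t (j + 1)) := by
  classical
  have hex : ∃ k, x < t k := ⟨n, hn⟩
  have hpos : Nat.find hex ≠ 0 := fun h => by
    have := Nat.find_spec hex
    rw [h] at this; linarith
  obtain ⟨k, hk⟩ := Nat.exists_eq_succ_of_ne_zero hpos
  refine ⟨k, ?_, ?_, ?_⟩
  · have := Nat.find_min' hex hn; omega
  · exact lt_of_le_of_ne (not_lt.1 (Nat.find_min hex (by omega))) (hx k).symm
  · have := Nat.find_spec hex
    rwa [hk] at this

theorem ae_ne_seq (μ : Measure ℝ) [NullSingletonClass μ] (t : ℕ → ℝ) : ∀ᵐ x ∂μ, ∀ j, x ≠ t j := by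
  rw [ae_all_iff]
  exact fun j => Measure.ae_ne μ (t j)

theorem stepFun_eq {n : ℕ} {t : ℕ → ℝ} (h : ∀ j < n, t j ≤ t (j + 1)) (a : ℕ → Fin M → ℤ)
    {j : ℕ} (hj : j < n) {x : ℝ} (hx : x ∈ Ioo (t j) (t (j + 1))) (i : Fin M) :
    stepFun n t a x i = a j i := by
  unfold stepFun
  rw [Finset.sum_eq_single j]
  · rw [indicator_of_mem (Ioo_subset_Ico_self hx)]
  · intro k hk hkj
    have hk := Finset.mem_range.1 hk
    refine indicator_of_notMem (fun hxk => ?_) _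
    rcases lt_or_gt_of_ne hkj with hlt | hlt
    · have := mono_of_le_succ h (show k + 1 ≤ j by omega) hj.le
      linarith [hxk.2, hx.1]
    · have := mono_of_le_succ h (show j + 1 ≤ k by omega) hk.le
      linarith [hxk.1, hx.2]
  · intro hj'; exact absurd (Finset.mem_range.2 hj) hj'

variable {V : Finset (Fin M → ℤ)} {u : L1Space T M} {n : ℕ} {t : ℕ → ℝ} {a : ℕ → Fin M → ℤ}

theorem IsRep.mono (h : IsRep V u n t a) {i j : ℕ} (hij : i ≤ j) (hj : j ≤ n) : t i ≤ t j :=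
  mono_of_le_succ h.t_le hij hj

theorem IsRep.n_pos (h : IsRep V u n t a) (hT : 0 < T) : 0 < n := by
  rcases Nat.eq_zero_or_pos n with rfl | hn
  · have := h.t_zero.symm.trans h.t_last; linarith
  · exact hn

theorem IsRep.ae_exists (h : IsRep V u n t a) : ∀ᵐ x ∂(volume.restrict (Ioo (0 : ℝ) T)),
    ∃ j < n, x ∈ Ioo (t j) (t (j + 1)) ∧ ∀ i, u x i = a j i := by
  filter_upwards [h.ae_eq, ae_ne_seq _ t, ae_restrict_mem measurableSet_Ioo] with x h1 h2 h3
  obtain ⟨j, hj, hx⟩ := exists_mem_Ioo_of_partition (n := n) (by rw [h.t_zero]; exact h3.1.le)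
    (by rw [h.t_last]; exact h3.2) h2
  exact ⟨j, hj, hx, h1 j hj hx⟩

theorem IsMinimalRep.isRep (h : IsMinimalRep V u n t a) : IsRep V u n t a where
  t_zero := h.t_zero
  t_last := h.t_last
  t_le j hj := (h.t_lt j hj).le
  a_mem := h.a_mem
  ae_eq := by
    filter_upwards [h.ae_eq] with x hx j hj hxj i
    rw [hx i, stepFun_eq (fun j hj => (h.t_lt j hj).le) a hj hxj]

theorem IsRep.isMinimalRep (h : IsRep V u n t a) (h1 : ∀ j < n, t j < t (j + 1))
    (h2 : ∀ j, j + 1 < n → a j ≠ a (j + 1)) : IsMinimalRep V u n t a where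
  t_zero := h.t_zero
  t_last := h.t_last
  t_lt := h1
  a_mem := h.a_mem
  a_ne := h2
  ae_eq := by
    filter_upwards [h.ae_exists] with x ⟨j, hj, hxj, hx⟩ i
    rw [hx i, stepFun_eq h.t_le a hj hxj]

/-- The integral of a function against a step function. -/
theorem IsRep.pairing_eq (h : IsRep V u n t a) (hT : 0 < T) {g : ℝ → Fin M → ℝ}
    (hm : AEStronglyMeasurable g (volume.restrict (Ioo (0 : ℝ) T))) {B : ℝ}
    (hB : ∀ᵐ x ∂(volume.restrict (Ioo (0 : ℝ) T)), ‖g x‖ ≤ B) :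
    ∫ x in Ioo (0 : ℝ) T, ∑ i, g x i * u x i =
      ∑ j ∈ Finset.range n, ∫ x in t j..t (j + 1), ∑ i, g x i * a j i := by
  have hint : IntegrableOn (fun x => ∑ i, g x i * u x i) (Ioc 0 T) :=
    (integrableOn_Ioc_iff_integrableOn_Ioo (by simp)).2 (integrable_pairing hm hB u)
  have hsub : ∀ j < n, Ioc (t j) (t (j + 1)) ⊆ Ioc 0 T := fun j hj => by
    refine Ioc_subset_Ioc ?_ ?_
    · rw [← h.t_zero]; exact h.mono (Nat.zero_le _) hj.le
    · rw [← h.t_last]; exact h.mono hj le_rfl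
  have e : ∫ x in Ioo (0 : ℝ) T, ∑ i, g x i * u x i = ∫ x in t 0..t n, ∑ i, g x i * u x i := by
    rw [h.t_zero, h.t_last, intervalIntegral.integral_of_le hT.le, integral_Ioc_eq_integral_Ioo]
  rw [e, ← intervalIntegral.sum_integral_adjacent_intervals (fun j hj =>
    (intervalIntegrable_iff_integrableOn_Ioc_of_le (h.t_le j hj)).2 (hint.mono_set (hsub j hj)))]
  refine Finset.sum_congr rfl fun j hj => ?_
  have hj := Finset.mem_range.1 hj
  rw [intervalIntegral.integral_of_le (h.t_le j hj), intervalIntegral.integral_of_le (h.t_le j hj),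
    integral_Ioc_eq_integral_Ioo, integral_Ioc_eq_integral_Ioo]
  refine setIntegral_congr_ae measurableSet_Ioo ?_
  have := (ae_restrict_iff' measurableSet_Ioo).1 h.ae_eq
  filter_upwards [this] with x hx hxj
  have hx0 : x ∈ Ioo 0 T := by
    refine ⟨?_, ?_⟩
    · rw [← h.t_zero]; exact (h.mono (Nat.zero_le _) hj.le).trans_lt hxj.1
    · rw [← h.t_last]; exact hxj.2.trans_le (h.mono hj le_rfl)
  exact Finset.sum_congr rfl fun i _ => by rw [hx hx0 j hj hxj i]

theorem sum_by_parts (b f : ℕ → ℝ) (n : ℕ) :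
    ∑ j ∈ Finset.range (n + 1), b j * (f (j + 1) - f j) =
      b n * f (n + 1) - b 0 * f 0 - ∑ j ∈ Finset.range n, (b (j + 1) - b j) * f (j + 1) := by
  induction n with
  | zero => simp; ring
  | succ n ih => rw [Finset.sum_range_succ, ih, Finset.sum_range_succ _ n]; ring

/-- Integration by parts for a step function. -/
theorem IsRep.integral_mul_deriv (h : IsRep V u n t a) (hT : 0 < T) {φ : ℝ → ℝ}
    (h1 : ContDiff ℝ 1 φ) (h2 : HasCompactSupport φ) (h3 : tsupport φ ⊆ Ioo 0 T) (i : Fin M) :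
    ∫ x in Ioo (0 : ℝ) T, u x i * deriv φ x =
      -∑ j ∈ Finset.range (n - 1), jump a j i * φ (t (j + 1)) := by
  classical
  have hc : Continuous (deriv φ) := h1.continuous_deriv le_rfl
  obtain ⟨B, hB⟩ := hc.bounded_above_of_compact_support h2.deriv
  -- The vector-valued formula is applied to the function whose only nonzero component is the i-th
  -- one.
  have hc' : Continuous fun x => (Pi.single i (deriv φ x) : Fin M → ℝ) :=
    (continuous_single i).comp hc
  have hB' : ∀ x, ‖(Pi.single i (deriv φ x) : Fin M → ℝ)‖ ≤ B := fun x => by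
    rw [Pi.norm_single]; exact hB x
  have key := h.pairing_eq hT hc'.aestronglyMeasurable (Eventually.of_forall hB')
  simp only [Pi.single_apply, ite_mul, zero_mul, Finset.sum_ite_eq', Finset.mem_univ, if_true] at key
  have hφ0 : φ (t 0) = 0 := image_eq_zero_of_notMem_tsupport fun h' => by
    have := (h3 h').1; rw [h.t_zero] at this; exact lt_irrefl _ this
  have hφn : φ (t n) = 0 := image_eq_zero_of_notMem_tsupport fun h' => by
    have := (h3 h').2; rw [h.t_last] at this; exact lt_irrefl _ this
  have hFTC : ∀ j, ∫ x in t j..t (j + 1), deriv φ x = φ (t (j + 1)) - φ (t j) := fun j =>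
    intervalIntegral.integral_deriv_eq_sub (fun x _ => (h1.differentiable one_ne_zero) x)
      (hc.intervalIntegrable _ _)
  simp_rw [mul_comm _ (deriv φ _)]
  rw [key]
  simp_rw [intervalIntegral.integral_mul_const, hFTC, mul_comm _ ((a _ i : ℝ))]
  obtain ⟨m, rfl⟩ : ∃ m, n = m + 1 := ⟨n - 1, by have := h.n_pos hT; omega⟩
  rw [sum_by_parts (fun j => (a j i : ℝ)) (fun j => φ (t j)), hφ0, hφn]
  simp [jump]

/-- Integration by parts leaves the values of the test function at the switching points, and
Hölder's inequality bounds each term. Nondegeneracy plays no role, so the bound also serves for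
limits of partitions and for displaced switches. -/
theorem IsRep.TVp_le (h : IsRep V u n t a) (hT : 0 < T) {p : ℝ≥0∞} (hp : 1 ≤ p) :
    TVp p u ≤ ENNReal.ofReal (∑ j ∈ Finset.range (n - 1), pNorm p (jump a j)) := by
  refine iSup₂_le fun φ hφ => ENNReal.ofReal_le_ofReal ?_
  obtain ⟨h1, h2, h3, h4⟩ := hφ
  have hcomp : ∀ i, ContDiff ℝ 1 fun x => φ x i := fun i => contDiff_pi.1 h1 i
  have hsupp : ∀ i, tsupport (fun x => φ x i) ⊆ tsupport φ := fun i =>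
    closure_mono fun x hx hx' => hx (by simp [hx'])
  have hcs : ∀ i, HasCompactSupport fun x => φ x i := fun i =>
    h2.mono' ((subset_tsupport _).trans (hsupp i))
  have hd : ∀ x i, deriv φ x i = deriv (fun x => φ x i) x := fun x i => by
    rw [deriv_pi fun i => ((hcomp i).differentiable one_ne_zero) x]
  have hint : ∀ i, Integrable (fun x => u x i * deriv (fun x => φ x i) x)
      (volume.restrict (Ioo (0 : ℝ) T)) := fun i => by
    obtain ⟨B, hB⟩ := ((hcomp i).continuous_deriv le_rfl).bounded_above_of_compact_support (hcs i).deriv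
    exact (integrable_apply u i).mul_bdd (c := B)
      ((hcomp i).continuous_deriv le_rfl).aestronglyMeasurable (Eventually.of_forall hB)
  simp_rw [hd]
  rw [integral_finsetSum _ fun i _ => hint i]
  simp_rw [h.integral_mul_deriv hT (hcomp _) (hcs _) ((hsupp _).trans h3)]
  rw [Finset.sum_neg_distrib, Finset.sum_comm, ← Finset.sum_neg_distrib]
  refine Finset.sum_le_sum fun j _ => ?_
  have := sum_mul_le_pNorm_mul hp (-jump a j) (φ (t (j + 1)))
  rw [pNorm_neg hp] at this
  simp only [Pi.neg_apply, neg_mul, Finset.sum_neg_distrib] at this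
  exact this.trans (mul_le_of_le_one_right (pNorm_nonneg hp _) (h4 _))

theorem IsRep.TVp_lt_top (h : IsRep V u n t a) (hT : 0 < T) {p : ℝ≥0∞} (hp : 1 ≤ p) :
    TVp p u < ⊤ := (h.TVp_le hT hp).trans_lt ENNReal.ofReal_lt_top

theorem IsRep.mem_Uad (h : IsRep V u n t a) (hT : 0 < T) : u ∈ Uad T V := by
  refine ⟨h.TVp_lt_top hT one_le_two, ?_⟩
  filter_upwards [h.ae_exists] with x ⟨j, hj, _, hx⟩
  exact ⟨a j, h.a_mem j hj, hx⟩

/-- Every interval has positive measure and so contains a point where u is the limit of its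
mollifications and has the right value. The increments between these points are the jumps. -/
theorem IsRep.TVp_eq (h : IsRep V u n t a) (hT : 0 < T) (hlt : ∀ j < n, t j < t (j + 1))
    {p : ℝ≥0∞} (hp : 1 ≤ p) :
    TVp p u = ENNReal.ofReal (∑ j ∈ Finset.range (n - 1), pNorm p (jump a j)) := by
  refine le_antisymm (h.TVp_le hT hp) ?_
  have hn := h.n_pos hT
  have hex : ∀ j < n, ∃ s ∈ Ioo (t j) (t (j + 1)), s ∈ mollPoints u ∧ ∀ i, u s i = a j i := by
    intro j hj
    have hsub : Ioo (t j) (t (j + 1)) ⊆ Ioo 0 T := by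
      refine Ioo_subset_Ioo ?_ ?_
      · rw [← h.t_zero]; exact h.mono (Nat.zero_le _) hj.le
      · rw [← h.t_last]; exact h.mono hj le_rfl
    have h1 : ∀ᵐ s ∂(volume.restrict (Ioo (t j) (t (j + 1)))),
        s ∈ Ioo (t j) (t (j + 1)) ∧ s ∈ mollPoints u ∧ ∀ i, u s i = a j i := by
      filter_upwards [ae_restrict_mem measurableSet_Ioo, ae_restrict_of_ae_restrict_of_subset hsub
        (ae_mem_mollPoints u), ae_restrict_of_ae_restrict_of_subset hsub h.ae_eq] with s h1 h2 h3
      exact ⟨h1, h2, h3 j hj h1⟩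
    have : NeBot (ae (volume.restrict (Ioo (t j) (t (j + 1))))) := by
      rw [ae_neBot, Ne, Measure.restrict_eq_zero]
      simp [hlt j hj]
    obtain ⟨s, hs⟩ := h1.exists
    exact ⟨s, hs⟩
  choose! s hs1 hs2 hs3 using hex
  -- Clamping the index extends the finite list of sample points to a monotone sequence on all of ℕ.
  set m : ℕ → ℕ := fun j => min j (n - 1) with hm
  have hmn : ∀ j, m j < n := fun j => by simp only [hm]; omega
  have hmono : Monotone fun j => s (m j) := by
    refine monotone_nat_of_le_succ fun j => ?_
    rcases Nat.lt_or_ge j (n - 1) with hj | hj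
    · have e1 : m j = j := by simp only [hm]; omega
      have e2 : m (j + 1) = j + 1 := by simp only [hm]; omega
      rw [e1, e2]
      exact ((hs1 j (by omega)).2.trans (hs1 (j + 1) (by omega)).1).le
    · have : m (j + 1) = m j := by simp only [hm]; omega
      rw [this]
  refine le_trans (ENNReal.ofReal_le_ofReal (Finset.sum_le_sum fun j hj => ?_))
    (sum_jumps_le_TVp hp u (n - 1) hmono fun j => hs2 _ (hmn j))
  have hj := Finset.mem_range.1 hj
  have e1 : m j = j := by simp only [hm]; omega
  have e2 : m (j + 1) = j + 1 := by simp only [hm]; omega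
  simp only [e1, e2]
  rw [show jump a j = fun i => u (s (j + 1)) i - u (s j) i from funext fun i => by
    rw [hs3 j (by omega), hs3 (j + 1) (by omega)]; rfl]

/-- Every function of finite total variation with finitely many integer values is a step
function. -/
theorem exists_isRep (hT : 0 < T) (hV : V.Nonempty) (hu : u ∈ Uad T V) :
    ∃ n t a, IsRep V u n t a := by
  classical
  set S : Set ℝ := {x | x ∈ mollPoints u ∧ ∃ ν ∈ V, ∀ i, u x i = (ν i : ℝ)} with hS
  have hSae : ∀ᵐ x ∂(volume.restrict (Ioo (0 : ℝ) T)), x ∈ S := by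
    filter_upwards [ae_mem_mollPoints u, hu.2] with x h1 h2 using ⟨h1, h2⟩
  set f : ℝ → PiLp 2 fun _ : Fin M => ℝ := fun x => WithLp.toLp 2 fun i => u x i with hf
  have hvar : eVariationOn f S ≤ TVp 2 u := by
    refine iSup_le fun ⟨k, s, hs, hsS⟩ => ?_
    refine le_trans (le_of_eq ?_) (sum_jumps_le_TVp one_le_two u k hs fun j => (hsS j).1)
    rw [ENNReal.ofReal_sum_of_nonneg fun j _ => pNorm_nonneg one_le_two _]
    refine Finset.sum_congr rfl fun j _ => ?_
    exact edist_toLp one_le_two _ _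
  have hfin : ∀ x, eVariationOn f (S ∩ Iic x) ≠ ⊤ := fun x =>
    (((eVariationOn.mono f inter_subset_left).trans hvar).trans_lt hu.1).ne
  -- W is the variation of u up to x. By integrality it grows by at least one between points of S at
  -- which u differs, so u is constant on the part of S where the integer part N of W is constant.
  -- Since N is monotone and bounded, its level sets are finitely many intervals.
  set W : ℝ → ℝ := fun x => (eVariationOn f (S ∩ Iic x)).toReal with hW
  have hWmono : Monotone W := fun x y hxy => ENNReal.toReal_mono (hfin y)
    (eVariationOn.mono f (inter_subset_inter_right _ (Iic_subset_Iic.2 hxy)))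
  have hWjump : ∀ x ∈ S, ∀ y ∈ S, x < y → (∃ i, u x i ≠ u y i) → W x + 1 ≤ W y := by
    rintro x hx y hy hxy ⟨i, hi⟩
    obtain ⟨ν, -, hν⟩ := hx.2
    obtain ⟨ν', -, hν'⟩ := hy.2
    have h1 : 1 ≤ edist (f x) (f y) := by
      rw [hf]
      refine le_trans ?_ (edist_toLp one_le_two _ _).ge
      refine ENNReal.ofReal_one.symm.le.trans (ENNReal.ofReal_le_ofReal ?_)
      have : ((fun i => u x i) - fun i => u y i) = fun i => (((ν - ν') i : ℤ) : ℝ) := by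
        ext i; simp [hν i, hν' i]
      rw [this]
      refine one_le_pNorm_of_int one_le_two fun h0 => hi ?_
      rw [hν i, hν' i, sub_eq_zero.1 h0]
    have h2 : eVariationOn f (S ∩ Iic x) + edist (f x) (f y) ≤ eVariationOn f (S ∩ Iic y) := by
      rw [← eVariationOn.pair]
      refine (eVariationOn.add_le_union f ?_).trans (eVariationOn.mono f ?_)
      · rintro z ⟨-, hz⟩ w (rfl | rfl)
        · exact hz
        · exact le_trans hz hxy.le
      · rintro z (⟨hz, hz'⟩ | rfl | rfl)
        · exact ⟨hz, le_trans hz' hxy.le⟩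
        · exact ⟨hx, hxy.le⟩
        · exact ⟨hy, self_mem_Iic⟩
    have h3 := (add_le_add_right h1 _).trans h2
    have := ENNReal.toReal_mono (hfin y) h3
    rwa [ENNReal.toReal_add (hfin x) ENNReal.one_ne_top, ENNReal.toReal_one] at this
  set N : ℝ → ℕ := fun x => ⌊W x⌋₊ with hN
  have hNmono : Monotone N := fun x y hxy => Nat.floor_mono (hWmono hxy)
  have hNeq : ∀ x ∈ S, ∀ y ∈ S, N x = N y → ∀ i, u x i = u y i := by
    have hlt : ∀ x ∈ S, ∀ y ∈ S, x < y → N x = N y → ∀ i, u x i = u y i := by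
      intro x hx y hy hxy hNxy
      by_contra! hne
      have := hWjump x hx y hy hxy hne
      have h2 : N x + 1 ≤ N y := by
        rw [hN]
        simp only
        rw [← Nat.floor_add_one ENNReal.toReal_nonneg]
        exact Nat.floor_mono this
      omega
    intro x hx y hy hxy i
    rcases lt_trichotomy x y with h | rfl | h
    · exact hlt x hx y hy h hxy i
    · rfl
    · exact (hlt y hy x hx h hxy.symm i).symm
  set K := ⌊(TVp 2 u).toReal⌋₊ with hK
  have hNK : ∀ x, N x ≤ K := fun x => Nat.floor_mono
    (ENNReal.toReal_mono (show TVp 2 u < ⊤ from hu.1).ne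
      ((eVariationOn.mono f inter_subset_left).trans hvar))
  -- The infimum of `A j` is the first time at which N reaches j. The point T is added so that a
  -- level that is never reached gets the switching time T.
  set A : ℕ → Set ℝ := fun j => {x | x ∈ Icc 0 T ∧ j ≤ N x} ∪ {T} with hA
  have hAsub : ∀ j, A j ⊆ Icc 0 T := fun j x hx => by
    rcases hx with hx | rfl
    · exact hx.1
    · exact ⟨hT.le, le_rfl⟩
  have hAbdd : ∀ j, BddBelow (A j) := fun j => ⟨0, fun x hx => (hAsub j hx).1⟩
  have hAne : ∀ j, (A j).Nonempty := fun j => ⟨T, Or.inr rfl⟩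
  obtain ⟨v0, hv0⟩ := hV
  choose! ν hνV hν using fun (x : ℝ) (hx : x ∈ S) => hx.2
  -- The default value v0 is used only for levels that N does not take on S; the corresponding
  -- intervals are null sets.
  refine ⟨K + 1, fun j => sInf (A j),
    fun j => if hx : ∃ x ∈ S, N x = j then ν hx.choose else v0, ?_, ?_, ?_, ?_, ?_⟩
  · refine le_antisymm (csInf_le (hAbdd 0) (Or.inl ⟨⟨le_rfl, hT.le⟩, Nat.zero_le _⟩)) ?_
    exact le_csInf (hAne 0) fun x hx => (hAsub 0 hx).1
  · have : A (K + 1) = {T} := by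
      rw [hA]
      simp only [union_eq_right]
      rintro x ⟨-, hx⟩
      have := hNK x; omega
    simp only [this, csInf_singleton]
  · intro j _
    refine csInf_le_csInf (hAbdd j) (hAne _) ?_
    rintro x (⟨hx, hx'⟩ | rfl)
    · exact Or.inl ⟨hx, by omega⟩
    · exact Or.inr rfl
  · intro j _
    split_ifs with hx
    · exact hνV _ hx.choose_spec.1
    · exact hv0
  · filter_upwards [hSae, ae_restrict_mem measurableSet_Ioo] with x hxS hxT j _ hxj i
    have hNx : N x = j := by
      obtain ⟨y, hy, hyx⟩ := exists_lt_of_csInf_lt (hAne j) hxj.1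
      have h1 : j ≤ N x := by
        rcases hy with hy | rfl
        · exact hy.2.trans (hNmono hyx.le)
        · exact absurd hxT.2 (not_lt.2 hyx.le)
      have h2 : ¬ j + 1 ≤ N x := fun h2 => absurd hxj.2
        (not_lt.2 (csInf_le (hAbdd _) (Or.inl ⟨⟨hxT.1.le, hxT.2.le⟩, h2⟩)))
      omega
    have hex : ∃ x ∈ S, N x = j := ⟨x, hxS, hNx⟩
    rw [dif_pos hex, ← hν _ hex.choose_spec.1 i]
    exact hNeq x hxS _ hex.choose_spec.1 (hNx.trans hex.choose_spec.2.symm) i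

/-- The increasing enumeration of the natural numbers different from `j`. -/
def skip (j i : ℕ) : ℕ := if i < j then i else i + 1

/-- A degenerate interval, or a point at which the value does not change, can be removed. -/
theorem IsRep.remove (h : IsRep V u (n + 1) t a) {j : ℕ} (hj : j < n + 1)
    (hdeg : t j = t (j + 1) ∨ (j < n ∧ a j = a (j + 1))) :
    IsRep V u n (t ∘ skip (j + 1)) (a ∘ skip j) := by
  refine ⟨?_, ?_, ?_, ?_, ?_⟩
  · simpa [skip] using h.t_zero
  -- When the last interval is removed, the discarded time is T itself, but the time before it
  -- equals T.
  · rcases Nat.lt_or_ge n (j + 1) with hn | hn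
    · have hjn : j = n := by omega
      subst hjn
      have h1 : t j = t (j + 1) := hdeg.resolve_right fun h' => lt_irrefl _ h'.1
      simp only [Function.comp, skip, if_pos hn]
      rw [h1, h.t_last]
    · simp only [Function.comp, skip, if_neg (not_lt.2 hn)]
      exact h.t_last
  · intro i hi
    refine h.mono ?_ ?_ <;> simp only [skip] <;> split_ifs <;> omega
  · intro i hi
    refine h.a_mem _ ?_
    simp only [skip]; split_ifs <;> omega
  · filter_upwards [h.ae_eq, ae_ne_seq _ t] with x hx hne i hi hxi l
    simp only [Function.comp, skip] at hxi ⊢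
    rcases lt_trichotomy i j with hij | rfl | hij
    · rw [if_pos (by omega), if_pos (by omega)] at hxi
      rw [if_pos hij]
      exact hx i (by omega) hxi l
    -- The merged interval. If the removed piece is degenerate, only the following interval is left;
    -- otherwise both pieces carry the same value, and x avoids the point between them.
    · rw [if_pos (by omega), if_neg (by omega)] at hxi
      rw [if_neg (lt_irrefl _)]
      rcases hdeg with hd | ⟨-, hd⟩
      · exact hx (i + 1) (by omega) ⟨hd ▸ hxi.1, hxi.2⟩ l
      · rcases lt_or_gt_of_ne (hne (i + 1)) with hlt | hgt
        · rw [← hd]; exact hx i (by omega) ⟨hxi.1, hlt⟩ l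
        · exact hx (i + 1) (by omega) ⟨hgt, hxi.2⟩ l
    · rw [if_neg (by omega), if_neg (by omega)] at hxi
      rw [if_neg (by omega)]
      exact hx (i + 1) (by omega) hxi l

/-- A representation with the fewest intervals has neither degenerate intervals nor equal
consecutive values, as either could be removed. -/
theorem exists_isMinimalRep (hT : 0 < T) (hV : V.Nonempty) (hu : u ∈ Uad T V) :
    ∃ n t a, IsMinimalRep V u n t a := by
  classical
  have hex : ∃ n t a, IsRep V u n t a := exists_isRep hT hV hu
  obtain ⟨t, a, h⟩ := Nat.find_spec hex
  have hmin := fun m (hm : m < Nat.find hex) => Nat.find_min hex hm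
  obtain ⟨m, hm⟩ : ∃ m, Nat.find hex = m + 1 := ⟨Nat.find hex - 1, by have := h.n_pos hT; omega⟩
  rw [hm] at h hmin
  refine ⟨m + 1, t, a, h.isMinimalRep (fun j hj => (h.t_le j hj).lt_of_ne fun he => ?_)
    fun j hj he => ?_⟩
  · exact hmin m (Nat.lt_succ_self m) ⟨_, _, h.remove hj (Or.inl he)⟩
  · exact hmin m (Nat.lt_succ_self m) ⟨_, _, h.remove (j := j) (by omega) (Or.inr ⟨by omega, he⟩)⟩

theorem measurable_stepFun (n : ℕ) (t : ℕ → ℝ) (a : ℕ → Fin M → ℤ) : Measurable (stepFun n t a) := by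
  refine measurable_pi_iff.2 fun i => ?_
  unfold stepFun
  exact Finset.measurable_fun_sum _ fun j _ => measurable_const.indicator measurableSet_Ico

/-- Every partition with values in `V` is the representation of a control. -/
theorem exists_of_partition (h0 : t 0 = 0) (hn : t n = T) (hle : ∀ j < n, t j ≤ t (j + 1))
    (ha : ∀ j < n, a j ∈ V) : ∃ u : L1Space T M, IsRep V u n t a := by
  set f : ℝ → PiLp 1 fun _ : Fin M => ℝ := fun x => WithLp.toLp 1 (stepFun n t a x) with hf
  have hmeas : AEStronglyMeasurable f (volume.restrict (Ioo (0 : ℝ) T)) := by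
    refine AEStronglyMeasurable.comp_aemeasurable (g := WithLp.toLp 1) ?_
      (measurable_stepFun n t a).aemeasurable
    exact (PiLp.continuous_toLp 1 _).aestronglyMeasurable
  have hmem : MemLp f 1 (volume.restrict (Ioo (0 : ℝ) T)) := by
    refine MemLp.of_bound hmeas (∑ i, ∑ j ∈ Finset.range n, |(a j i : ℝ)|)
      (Eventually.of_forall fun x => ?_)
    rw [PiLp.norm_eq_of_L1]
    refine Finset.sum_le_sum fun i _ => ?_
    change ‖stepFun n t a x i‖ ≤ _
    unfold stepFun
    refine (norm_sum_le _ _).trans (Finset.sum_le_sum fun j _ => ?_)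
    exact norm_indicator_le_norm_self (fun _ => (a j i : ℝ)) x
  refine ⟨hmem.toLp f, h0, hn, hle, ha, ?_⟩
  filter_upwards [hmem.coeFn_toLp] with x hx j hj hxj i
  rw [hx]
  exact stepFun_eq hle a hj hxj i

end

/-! ### Compactness of controls with bounded variation -/

section

variable {T : ℝ} {M : ℕ}
variable {V : Finset (Fin M → ℤ)} {u : L1Space T M} {n : ℕ} {t : ℕ → ℝ} {a : ℕ → Fin M → ℤ}

theorem one_le_pNorm_jump {p : ℝ≥0∞} (hp : 1 ≤ p) {j : ℕ} (h : a j ≠ a (j + 1)) :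
    1 ≤ pNorm p (jump a j) := by
  have := one_le_pNorm_of_int hp (x := a (j + 1) - a j) (sub_ne_zero.2 h.symm)
  simp only [Pi.sub_apply, Int.cast_sub] at this
  exact this

/-- Distinct integer values have distance at least one, so the variation counts the switches from
above. -/
theorem IsMinimalRep.le_TVp (h : IsMinimalRep V u n t a) (hT : 0 < T) {p : ℝ≥0∞} (hp : 1 ≤ p) :
    ENNReal.ofReal ((n - 1 : ℕ) : ℝ) ≤ TVp p u := by
  rw [h.isRep.TVp_eq hT h.t_lt hp]
  refine ENNReal.ofReal_le_ofReal ?_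
  calc ((n - 1 : ℕ) : ℝ) = ∑ j ∈ Finset.range (n - 1), (1 : ℝ) := by simp
    _ ≤ _ := Finset.sum_le_sum fun j hj => one_le_pNorm_jump hp (h.a_ne j (by
      have := Finset.mem_range.1 hj; omega))

theorem IsMinimalRep.congr {a' : ℕ → Fin M → ℤ} (h : IsMinimalRep V u n t a)
    (ha : ∀ j < n, a j = a' j) : IsMinimalRep V u n t a' where
  t_zero := h.t_zero
  t_last := h.t_last
  t_lt := h.t_lt
  a_mem j hj := ha j hj ▸ h.a_mem j hj
  a_ne j hj := by rw [← ha j (by omega), ← ha (j + 1) hj]; exact h.a_ne j hj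
  ae_eq := by
    filter_upwards [h.ae_eq] with x hx i
    rw [hx i]
    exact Finset.sum_congr rfl fun j hj => by rw [ha j (Finset.mem_range.1 hj)]

/-- Controls of bounded total variation have a subsequence with a fixed number of switches, fixed
values and convergent switching times. -/
theorem exists_subseq_isMinimalRep (hT : 0 < T) (hV : V.Nonempty) {w : ℕ → L1Space T M}
    (hw : ∀ k, w k ∈ Uad T V) {p : ℝ≥0∞} (hp : 1 ≤ p) {C : ℝ≥0∞} (hC : C ≠ ⊤)
    (hwC : ∀ k, TVp p (w k) ≤ C) :
    ∃ φ : ℕ → ℕ, StrictMono φ ∧ ∃ (n : ℕ) (a : ℕ → Fin M → ℤ) (τ : ℕ → ℕ → ℝ) (t : ℕ → ℝ),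
      (∀ k, IsMinimalRep V (w (φ k)) n (τ k) a) ∧
      ∀ j ≤ n, Tendsto (fun k => τ k j) atTop (𝓝 (t j)) := by
  classical
  choose m τ b hrep using fun k => exists_isMinimalRep hT hV (hw k)
  set R := ⌊C.toReal⌋₊ + 1 with hR
  have hmR : ∀ k, m k < R + 1 := fun k => by
    have h1 := ((hrep k).le_TVp hT hp).trans (hwC k)
    have h2 := ENNReal.toReal_mono hC h1
    rw [ENNReal.toReal_ofReal (Nat.cast_nonneg _)] at h2
    have := Nat.le_floor h2
    omega
  obtain ⟨v0, hv0⟩ := hV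
  have hτ : ∀ k, ∀ j ≤ m k, τ k j ∈ Icc 0 T := fun k j hj => by
    refine ⟨?_, ?_⟩
    · rw [← (hrep k).t_zero]; exact (hrep k).isRep.mono (Nat.zero_le _) hj
    · rw [← (hrep k).t_last]; exact (hrep k).isRep.mono hj le_rfl
  -- Number of intervals, values and times, padded by defaults beyond `m k`, form a point of a
  -- sequentially compact product space.
  set X : ℕ → Fin (R + 1) × (ℕ → V) × (ℕ → Icc (0 : ℝ) T) := fun k =>
    (⟨m k, hmR k⟩, fun j => if h : j < m k then ⟨b k j, (hrep k).a_mem j h⟩ else ⟨v0, hv0⟩,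
      fun j => if h : j ≤ m k then ⟨τ k j, hτ k j h⟩ else ⟨0, le_rfl, hT.le⟩) with hX
  obtain ⟨⟨n, a, t⟩, φ, hφ, hlim⟩ := CompactSpace.tendsto_subseq X
  have h1 : ∀ᶠ k in atTop, m (φ k) = n := by
    have := (continuous_fst.tendsto _).comp hlim
    rw [nhds_discrete, tendsto_pure] at this
    filter_upwards [this] with k hk
    exact congrArg Fin.val hk
  have hlim2 := (continuous_snd.tendsto _).comp hlim
  have h2 : ∀ᶠ k in atTop, ∀ j < (n : ℕ), (X (φ k)).2.1 j = a j := by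
    have := (continuous_fst.tendsto _).comp hlim2
    rw [tendsto_pi_nhds] at this
    have h3 : ∀ j ∈ Finset.range n, ∀ᶠ k in atTop, (X (φ k)).2.1 j = a j := fun j _ => by
      have := this j
      rwa [nhds_discrete, tendsto_pure] at this
    filter_upwards [(Finset.eventually_all _).2 h3] with k hk j hj
    exact hk j (Finset.mem_range.2 hj)
  -- Convergence in a discrete factor means being eventually constant. Dropping finitely many terms
  -- makes the number of intervals and the relevant values exactly constant.
  obtain ⟨k0, hk0⟩ := eventually_atTop.1 (h1.and h2)
  have hk1 : ∀ k, m (φ (k + k0)) = n := fun k => (hk0 _ (Nat.le_add_left _ _)).1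
  refine ⟨fun k => φ (k + k0), fun k l hkl => hφ (by omega), n, fun j => a j,
    fun k => τ (φ (k + k0)), fun j => t j, fun k => ?_, fun j hj => ?_⟩
  · have h := hrep (φ (k + k0))
    rw [hk1 k] at h
    refine h.congr fun j hj => ?_
    have := (hk0 (k + k0) (Nat.le_add_left _ _)).2 j hj
    simp only [hX, hk1 k, dif_pos hj] at this
    rw [← this]
  · have h4 := (continuous_snd.tendsto _).comp hlim2
    rw [tendsto_pi_nhds] at h4
    have h5 := ((continuous_subtype_val.tendsto _).comp (h4 j)).comp (tendsto_add_atTop_nat k0)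
    refine h5.congr fun k => ?_
    simp only [Function.comp, hX, hk1 k, dif_pos hj]

theorem IsRep.ae_sum_abs_le (h : IsRep V u n t a) :
    ∀ᵐ x ∂(volume.restrict (Ioo (0 : ℝ) T)),
      ∑ i, |u x i| ≤ ∑ i, ∑ j ∈ Finset.range n, |(a j i : ℝ)| := by
  filter_upwards [h.ae_exists] with x ⟨j, hj, _, hx⟩
  refine Finset.sum_le_sum fun i _ => ?_
  rw [hx i]
  exact Finset.single_le_sum (f := fun j => |(a j i : ℝ)|) (fun _ _ => abs_nonneg _)
    (Finset.mem_range.2 hj)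

theorem norm_sub_eq_integral (u v : L1Space T M) :
    ‖u - v‖ = ∫ x in Ioo (0 : ℝ) T, ∑ i, |u x i - v x i| := by
  rw [norm_eq_integral]
  refine integral_congr_ae ?_
  filter_upwards [coeFn_sub_apply u v] with x hx
  simp_rw [hx]

/-- A point inside a limit interval eventually lies in the interval of the same index, so the
controls converge almost everywhere; they are uniformly bounded, and dominated convergence applies.
Intervals that degenerate in the limit are not seen. -/
theorem exists_tendsto_of_isRep {w : ℕ → L1Space T M} {τ : ℕ → ℕ → ℝ}
    (hw : ∀ k, IsRep V (w k) n (τ k) a) (ht : ∀ j ≤ n, Tendsto (fun k => τ k j) atTop (𝓝 (t j))) :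
    ∃ v, IsRep V v n t a ∧ Tendsto w atTop (𝓝 v) := by
  obtain ⟨v, hv⟩ : ∃ v : L1Space T M, IsRep V v n t a := by
    refine exists_of_partition ?_ ?_ (fun j hj => ?_) (hw 0).a_mem
    · refine tendsto_nhds_unique (ht 0 (Nat.zero_le _)) ?_
      simp_rw [(hw _).t_zero]; exact tendsto_const_nhds
    · refine tendsto_nhds_unique (ht n le_rfl) ?_
      simp_rw [(hw _).t_last]; exact tendsto_const_nhds
    · exact le_of_tendsto_of_tendsto' (ht j hj.le) (ht (j + 1) hj) fun k => (hw k).t_le j hj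
  refine ⟨v, hv, tendsto_iff_norm_sub_tendsto_zero.2 ?_⟩
  simp_rw [norm_sub_eq_integral]
  set B : ℝ := ∑ i, ∑ j ∈ Finset.range n, |(a j i : ℝ)| with hB
  have hlim := tendsto_integral_of_dominated_convergence
    (F := fun k x => ∑ i, |w k x i - v x i|) (f := fun _ => 0)
    (μ := volume.restrict (Ioo (0 : ℝ) T)) (fun _ => 2 * B) ?_ (integrable_const _) ?_ ?_
  · simpa using hlim
  · intro k
    exact (integrable_finsetSum _ fun i _ =>
      ((integrable_apply (w k) i).sub (integrable_apply v i)).abs).aestronglyMeasurable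
  · intro k
    filter_upwards [(hw k).ae_sum_abs_le, hv.ae_sum_abs_le] with x h1 h2
    rw [Real.norm_eq_abs, abs_of_nonneg (Finset.sum_nonneg fun _ _ => abs_nonneg _)]
    calc ∑ i, |w k x i - v x i| ≤ ∑ i, (|w k x i| + |v x i|) :=
          Finset.sum_le_sum fun i _ => abs_sub _ _
      _ ≤ 2 * B := by rw [Finset.sum_add_distrib]; linarith
  · filter_upwards [hv.ae_exists, ae_all_iff.2 fun k => (hw k).ae_eq] with x ⟨j, hj, hxj, hx⟩ hwx
    have e1 := (ht j hj.le).eventually_lt_const hxj.1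
    have e2 := (ht (j + 1) hj).eventually_const_lt hxj.2
    refine tendsto_const_nhds.congr' ?_
    filter_upwards [e1, e2] with k h1 h2
    refine (Finset.sum_eq_zero fun i _ => ?_).symm
    rw [hwx k j hj ⟨h1, h2⟩ i, hx i, sub_self, abs_zero]

/-- Bookkeeping for the removal of one interval: the neighbouring terms `f l` and `f (l + 1)` are
replaced by the single term `g l`. -/
theorem sum_range_merge {f g : ℕ → ℝ} {l r : ℕ} (h1 : ∀ i < l, g i = f i)
    (h2 : ∀ i, l < i → g i = f (i + 1)) :
    ∑ i ∈ Finset.range (l + 1 + r), g i + (f l + f (l + 1) - g l)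
      = ∑ i ∈ Finset.range (l + 1 + 1 + r), f i := by
  rw [Finset.sum_range_add, Finset.sum_range_add _ (l + 1 + 1), Finset.sum_range_succ,
    Finset.sum_range_succ, Finset.sum_range_succ]
  rw [Finset.sum_congr rfl fun i hi => h1 i (Finset.mem_range.1 hi)]
  rw [Finset.sum_congr rfl fun i _ => h2 (l + 1 + i) (by omega)]
  rw [Finset.sum_congr rfl fun i _ => show f (l + 1 + i + 1) = f (l + 1 + 1 + i) by
    congr 1; omega]
  ring

/-- If `1 < p < ∞` and the total variation of a step function is the sum of the `p`-norms of the
jumps of a representation, possibly with degenerate intervals, then the same holds for all other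
norms. -/
theorem IsRep.TVp_eq_of_eq (hT : 0 < T) {p : ℝ≥0∞} (hp : 1 < p) (hp' : p < ⊤) :
    ∀ {n : ℕ} {t : ℕ → ℝ} {a : ℕ → Fin M → ℤ}, IsRep V u n t a →
    (∀ j, j + 1 < n → a j ≠ a (j + 1)) →
    TVp p u = ENNReal.ofReal (∑ j ∈ Finset.range (n - 1), pNorm p (jump a j)) →
    ∀ {q : ℝ≥0∞}, 1 ≤ q →
    TVp q u = ENNReal.ofReal (∑ j ∈ Finset.range (n - 1), pNorm q (jump a j)) := by
  intro n
  induction n with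
  | zero => intro t a h; exact absurd (h.n_pos hT) (lt_irrefl _)
  | succ m ih =>
    intro t a h hne hTV q hq
    by_cases hlt : ∀ j < m + 1, t j < t (j + 1)
    · exact h.TVp_eq hT hlt hq
    push Not at hlt
    obtain ⟨j, hj, hjt⟩ := hlt
    have hdeg : t j = t (j + 1) := le_antisymm (h.t_le j hj) hjt
    -- The shorter representation also bounds the variation from above, so removing the degenerate
    -- interval must not decrease the sum of the jump norms.
    have h' := h.remove hj (Or.inl hdeg)
    have hm := h'.n_pos hT
    have hle := h'.TVp_le hT hp.le
    have hnn : ∀ (b : ℕ → Fin M → ℤ) k, 0 ≤ ∑ j ∈ Finset.range k, pNorm p (jump b j) := fun b k =>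
      Finset.sum_nonneg fun _ _ => pNorm_nonneg hp.le _
    rw [hTV, ENNReal.ofReal_le_ofReal_iff (hnn _ _), Nat.add_sub_cancel] at hle
    obtain ⟨r, rfl⟩ : ∃ r, m = r + 1 := ⟨m - 1, by omega⟩
    simp only [Nat.add_sub_cancel] at hle hTV ih ⊢
    -- A degenerate interval at either end would cost an entire jump, of norm at least one. In the
    -- interior, two jumps merge into their sum, and the triangle inequality has to be an equality.
    rcases Nat.eq_zero_or_pos j with rfl | hj0
    · exfalso
      rw [Finset.sum_range_succ'] at hle
      have h1 := one_le_pNorm_jump hp.le (hne 0 (by omega))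
      have h2 : ∀ i, jump (a ∘ skip 0) i = jump a (i + 1) := fun i => by
        ext l; simp [jump, skip]
      simp_rw [h2] at hle
      linarith
    rcases Nat.lt_or_ge r j with hjr | hjr
    · exfalso
      have hjr : j = r + 1 := by omega
      subst hjr
      rw [Finset.sum_range_succ] at hle
      have h1 := one_le_pNorm_jump hp.le (hne r (by omega))
      have h2 : ∀ i ∈ Finset.range r, pNorm p (jump (a ∘ skip (r + 1)) i) = pNorm p (jump a i) :=
        fun i hi => by
          have hi := Finset.mem_range.1 hi
          congr 1; ext l
          simp only [jump, skip, Function.comp]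
          rw [if_pos (by omega), if_pos (by omega)]
      rw [Finset.sum_congr rfl h2] at hle
      linarith
    obtain ⟨l, rfl⟩ : ∃ l, j = l + 1 := ⟨j - 1, by omega⟩
    obtain ⟨s, rfl⟩ : ∃ s, r = l + 1 + s := ⟨r - (l + 1), by omega⟩
    have g1 : ∀ i < l, jump (a ∘ skip (l + 1)) i = jump a i := fun i hi => by
      ext k; simp only [jump, skip, Function.comp]
      rw [if_pos (by omega), if_pos (by omega)]
    have g2 : ∀ i, l < i → jump (a ∘ skip (l + 1)) i = jump a (i + 1) := fun i hi => by
      ext k; simp only [jump, skip, Function.comp]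
      rw [if_neg (by omega), if_neg (by omega)]
    have g3 : jump (a ∘ skip (l + 1)) l = jump a l + jump a (l + 1) := by
      ext k; simp only [jump, skip, Function.comp, Pi.add_apply]
      rw [if_neg (by omega), if_pos (by omega)]
      ring
    have hsum : ∀ q : ℝ≥0∞, ∑ i ∈ Finset.range (l + 1 + s), pNorm q (jump (a ∘ skip (l + 1)) i)
        + (pNorm q (jump a l) + pNorm q (jump a (l + 1)) - pNorm q (jump a l + jump a (l + 1)))
        = ∑ i ∈ Finset.range (l + 1 + s + 1), pNorm q (jump a i) := fun q => by
      rw [← g3, show l + 1 + s + 1 = l + 1 + 1 + s by omega]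
      exact sum_range_merge (f := fun i => pNorm q (jump a i))
        (g := fun i => pNorm q (jump (a ∘ skip (l + 1)) i))
        (fun i hi => by rw [g1 i hi]) fun i hi => by rw [g2 i hi]
    have htri := pNorm_add_le hp.le (jump a l) (jump a (l + 1))
    have heq : pNorm p (jump a l + jump a (l + 1)) = pNorm p (jump a l) + pNorm p (jump a (l + 1)) := by
      have := hsum p
      linarith
    rw [← hsum q, pNorm_add_eq_of_eq hp hp' hq heq, sub_self, add_zero]
    -- Consecutive values remain distinct: the norm of the merged jump is the sum of two norms that
    -- are at least one.
    refine ih h' (fun i hi he => ?_) ?_ hq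
    · rcases lt_trichotomy i l with hil | rfl | hil
      · simp only [Function.comp, skip] at he
        rw [if_pos (by omega), if_pos (by omega)] at he
        exact hne i (by omega) he
      · have h1 := one_le_pNorm_jump hp.le (hne i (by omega))
        have h2 := pNorm_nonneg hp.le (jump a (i + 1))
        have h3 : jump (a ∘ skip (i + 1)) i = 0 := by
          ext k; simp only [jump]; rw [he]; simp
        rw [← g3, h3, pNorm_zero hp.le] at heq
        linarith
      · simp only [Function.comp, skip] at he
        rw [if_neg (by omega), if_neg (by omega)] at he
        exact hne (i + 1) (by omega) he
    · rw [hTV, ← hsum p, heq, sub_self, add_zero]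

end

/-! ### Weak-* convergence -/

section

variable {T : ℝ} {M : ℕ}
variable {V : Finset (Fin M → ℤ)} {u : L1Space T M} {n : ℕ} {t : ℕ → ℝ} {a : ℕ → Fin M → ℤ}

/-- The extension by zero of a function on `(0,T)`. -/
def zeroExt (φ : Ioo (0 : ℝ) T → ℝ) (x : ℝ) : ℝ := if h : x ∈ Ioo 0 T then φ ⟨x, h⟩ else 0

theorem zeroExt_coe (φ : Ioo (0 : ℝ) T → ℝ) (x : Ioo (0 : ℝ) T) : zeroExt φ x = φ x := by
  simp only [zeroExt, dif_pos x.2]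

/-- A function vanishing at infinity on (0,T) is small off a compact subset, and a point outside
(0,T) has a neighbourhood that misses this set. -/
theorem continuous_zeroExt (φ : C₀(Ioo (0 : ℝ) T, ℝ)) : Continuous (zeroExt φ) := by
  refine continuous_iff_continuousAt.2 fun x => ?_
  by_cases hx : x ∈ Ioo 0 T
  · have h : ContinuousOn (zeroExt φ) (Ioo 0 T) := by
      rw [continuousOn_iff_continuous_domRestrict]
      have : (Ioo 0 T).domRestrict (zeroExt φ) = φ := funext fun x => zeroExt_coe _ x
      rw [this]
      exact φ.continuous
    exact h.continuousAt (isOpen_Ioo.mem_nhds hx)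
  · have h0 : zeroExt φ x = 0 := dif_neg hx
    rw [ContinuousAt, h0, Metric.tendsto_nhds]
    intro ε hε
    have h1 := (Metric.tendsto_nhds.1 φ.zero_at_infty') ε hε
    obtain ⟨K, hK, hKs⟩ := mem_cocompact.1 h1
    have hK' : IsCompact ((↑) '' K : Set ℝ) := hK.image continuous_subtype_val
    have hx' : x ∉ ((↑) '' K : Set ℝ) := by
      rintro ⟨y, _, rfl⟩; exact hx y.2
    filter_upwards [hK'.isClosed.isOpen_compl.mem_nhds hx'] with y hy
    by_cases hyT : y ∈ Ioo 0 T
    · have : (⟨y, hyT⟩ : Ioo (0 : ℝ) T) ∈ Kᶜ := fun h => hy ⟨_, h, rfl⟩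
      have := hKs this
      simp only [zeroExt, dif_pos hyT]
      exact this
    · simp only [zeroExt, dif_neg hyT, dist_self]
      exact hε

/-- The distributional derivative of a step function: a sum of Dirac measures. -/
def stepDeriv (T : ℝ) (n : ℕ) (t : ℕ → ℝ) (a : ℕ → Fin M → ℤ) (i : Fin M) :
    SignedMeasure (Ioo (0 : ℝ) T) :=
  ∑ j ∈ Finset.range (n - 1),
    if h : t (j + 1) ∈ Ioo 0 T then VectorMeasure.dirac ⟨t (j + 1), h⟩ (jump a j i) else 0

theorem integrable_vectorMeasure_dirac (x : Ioo (0 : ℝ) T) (c : ℝ) (φ : Ioo (0 : ℝ) T → ℝ) :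
    (VectorMeasure.dirac x c).Integrable φ := by
  rw [VectorMeasure.Integrable, VectorMeasure.variation_dirac]
  exact (integrable_dirac (f := φ) (by simp)).smul_measure enorm_ne_top

theorem integral_stepDeriv (n : ℕ) (t : ℕ → ℝ) (a : ℕ → Fin M → ℤ) (i : Fin M)
    (φ : Ioo (0 : ℝ) T → ℝ) :
    ∫ᵛ x, φ x ∂•(stepDeriv T n t a i) =
      ∑ j ∈ Finset.range (n - 1), jump a j i * zeroExt φ (t (j + 1)) := by
  unfold stepDeriv
  rw [VectorMeasure.integral_finsetSum_vectorMeasure]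
  · refine Finset.sum_congr rfl fun j _ => ?_
    split_ifs with h
    · rw [VectorMeasure.integral_dirac, zeroExt, dif_pos h]
      simp [mul_comm]
    · rw [VectorMeasure.integral_zero_vectorMeasure, zeroExt, dif_neg h, mul_zero]
  · intro j _
    split_ifs with h
    · exact integrable_vectorMeasure_dirac _ _ _
    · exact VectorMeasure.Integrable.zero_vectorMeasure

theorem IsRep.isDistribDeriv (h : IsRep V u n t a) (hT : 0 < T) :
    IsDistribDeriv u (stepDeriv T n t a) := by
  intro i φ h1 h2 h3
  rw [h.integral_mul_deriv hT h1 h2 h3,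
    integral_stepDeriv n t a i fun x : Ioo (0 : ℝ) T => φ x]
  congr 1
  refine Finset.sum_congr rfl fun j _ => ?_
  congr 1
  by_cases hj : t (j + 1) ∈ Ioo 0 T
  · simp only [zeroExt, dif_pos hj]
  · simp only [zeroExt, dif_neg hj]
    exact image_eq_zero_of_notMem_tsupport fun h' => hj (h3 h')

theorem integral_comap_eq (u : L1Space T M) (i : Fin M) (φ : Ioo (0 : ℝ) T → ℝ) :
    ∫ x, u x i * φ x ∂(volume.comap ((↑) : Ioo (0 : ℝ) T → ℝ)) =
      ∫ x in Ioo (0 : ℝ) T, zeroExt φ x * u x i := by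
  rw [← integral_subtype_comap measurableSet_Ioo fun x => zeroExt φ x * u x i]
  exact integral_congr_ae (Eventually.of_forall fun x => by
    simp only [zeroExt_coe]; ring)

theorem exists_bound_zeroExt (φ : C₀(Ioo (0 : ℝ) T, ℝ)) : ∃ B, ∀ x, ‖zeroExt φ x‖ ≤ B := by
  refine ⟨‖φ.toBCF‖, fun x => ?_⟩
  unfold zeroExt
  split_ifs with h
  · exact φ.toBCF.norm_coe_le_norm _
  · simp

theorem continuous_integral_comap (i : Fin M) (φ : C₀(Ioo (0 : ℝ) T, ℝ)) :
    Continuous fun u : L1Space T M =>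
      ∫ x, u x i * φ x ∂(volume.comap ((↑) : Ioo (0 : ℝ) T → ℝ)) := by
  classical
  obtain ⟨B, hB⟩ := exists_bound_zeroExt φ
  have h := continuous_pairing (T := T) (h := fun x => (Pi.single i (zeroExt φ x) : Fin M → ℝ))
    ((continuous_single i).comp (continuous_zeroExt φ)).aestronglyMeasurable (B := B)
    (Eventually.of_forall fun x => by rw [Pi.norm_single]; exact hB x)
  simp only [Pi.single_apply, ite_mul, zero_mul, Finset.sum_ite_eq', Finset.mem_univ, if_true] at h
  simp_rw [integral_comap_eq]
  exact h

/-- The derivatives are sums of Dirac masses with fixed weights at convergent points. Masses that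
move to 0 or T disappear in the limit, because the zero extension of the test function is continuous
there. -/
theorem weakStarTendsto_of_isRep (hT : 0 < T) {w : ℕ → L1Space T M} {v : L1Space T M}
    {τ : ℕ → ℕ → ℝ} (hw : ∀ k, IsRep V (w k) n (τ k) a) (hv : IsRep V v n t a)
    (ht : ∀ j ≤ n, Tendsto (fun k => τ k j) atTop (𝓝 (t j))) (hwv : Tendsto w atTop (𝓝 v)) :
    WeakStarTendsto w v := by
  refine ⟨fun k => ((hw k).mem_Uad hT).1, (hv.mem_Uad hT).1, fun k => stepDeriv T n (τ k) a,
    stepDeriv T n t a, fun k => (hw k).isDistribDeriv hT, hv.isDistribDeriv hT, fun i φ => ⟨?_, ?_⟩⟩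
  · exact ((continuous_integral_comap i φ).tendsto v).comp hwv
  · simp_rw [integral_stepDeriv]
    refine tendsto_finsetSum _ fun j hj => Tendsto.const_mul _ ?_
    have := Finset.mem_range.1 hj
    exact ((continuous_zeroExt φ).tendsto _).comp (ht (j + 1) (by omega))

/-- An integrable function is determined by its integrals against functions in `C_0(0,T)`. -/
theorem eq_of_integral_comap_eq {v w : L1Space T M}
    (h : ∀ (i : Fin M) (φ : C₀(Ioo (0 : ℝ) T, ℝ)),
      ∫ x, v x i * φ x ∂(volume.comap ((↑) : Ioo (0 : ℝ) T → ℝ)) =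
        ∫ x, w x i * φ x ∂(volume.comap ((↑) : Ioo (0 : ℝ) T → ℝ))) : v = w := by
  have key : ∀ i, ∀ᵐ x, x ∈ Ioo 0 T → v x i - w x i = 0 := by
    intro i
    refine isOpen_Ioo.ae_eq_zero_of_integral_contDiff_smul_eq_zero ?_ fun g hg1 hg2 hg3 => ?_
    · exact IntegrableOn.locallyIntegrableOn ((integrable_apply v i).sub (integrable_apply w i))
    -- Smooth functions with compact support in (0,T) belong to C_0, so the fundamental lemma of the
    -- calculus of variations applies.
    · set φ : C₀(Ioo (0 : ℝ) T, ℝ) :=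
        { toFun := fun x => g x
          continuous_toFun := hg1.continuous.comp continuous_subtype_val
          zero_at_infty' := by
            refine Metric.tendsto_nhds.2 fun ε hε => mem_cocompact.2
              ⟨(↑) ⁻¹' tsupport g, ?_, fun x hx => ?_⟩
            · exact (Topology.IsInducing.subtypeVal.isCompact_preimage_iff
                (by rwa [Subtype.range_coe])).2 hg2
            · have : g x = 0 := image_eq_zero_of_notMem_tsupport hx
              simp [this, hε] } with hφ
      have hz : ∀ x, zeroExt φ x = g x := fun x => by
        by_cases hx : x ∈ Ioo 0 T
        · simp only [zeroExt, dif_pos hx]; rfl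
        · simp only [zeroExt, dif_neg hx]
          exact (image_eq_zero_of_notMem_tsupport fun h' => hx (hg3 h')).symm
      obtain ⟨B, hB⟩ := exists_bound_zeroExt φ
      have hint : ∀ y : L1Space T M, Integrable (fun x => zeroExt φ x * y x i)
          (volume.restrict (Ioo (0 : ℝ) T)) := fun y =>
        (integrable_apply y i).bdd_mul (c := B) (continuous_zeroExt φ).aestronglyMeasurable
          (Eventually.of_forall hB)
      have h1 := h i φ
      rw [integral_comap_eq, integral_comap_eq, ← sub_eq_zero, ← integral_sub (hint v) (hint w)] at h1
      refine (setIntegral_eq_integral_of_forall_compl_eq_zero (s := Ioo 0 T)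
        fun x hx => ?_).symm.trans ?_
      rotate_left
      · refine Eq.trans ?_ h1
        refine integral_congr_ae (Eventually.of_forall fun x => ?_)
        simp only [hz, smul_eq_mul]; ring
      · rw [image_eq_zero_of_notMem_tsupport fun h' => hx (hg3 h'), zero_smul]
  refine Lp.ext ?_
  rw [EventuallyEq, ae_restrict_iff' measurableSet_Ioo]
  filter_upwards [ae_all_iff.2 key] with x hx hxT
  ext i
  exact sub_eq_zero.1 (hx i hxT)

/-- Weak-* convergence of controls with bounded total variation implies convergence in `L^1`. -/
theorem WeakStarTendsto.tendsto (hT : 0 < T) (hV : V.Nonempty) {w : ℕ → L1Space T M}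
    {v : L1Space T M} (h : WeakStarTendsto w v) (hw : ∀ k, w k ∈ Uad T V) {p : ℝ≥0∞} (hp : 1 ≤ p)
    {C : ℝ≥0∞} (hC : C ≠ ⊤) (hwC : ∀ k, TVp p (w k) ≤ C) : Tendsto w atTop (𝓝 v) := by
  -- Every subsequence has a further one that converges in L^1, and the pairing with C_0 identifies
  -- its limit as v. The convergence of the derivatives is not needed.
  refine tendsto_of_subseq_tendsto fun ns hns => ?_
  obtain ⟨φ, hφ, n, a, τ, t, hrep, ht⟩ :=
    exists_subseq_isMinimalRep hT hV (fun k => hw (ns k)) hp hC fun k => hwC (ns k)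
  obtain ⟨v', -, hv'⟩ := exists_tendsto_of_isRep (fun k => (hrep k).isRep) ht
  have : v = v' := by
    refine eq_of_integral_comap_eq fun i ψ => ?_
    obtain ⟨-, -, Dw, Dv, -, -, hlim⟩ := h
    exact tendsto_nhds_unique (((hlim i ψ).1.comp hns).comp hφ.tendsto_atTop)
      (((continuous_integral_comap i ψ).tendsto v').comp hv')
  exact ⟨φ, this ▸ hv'⟩

/-- Bounded sequences of controls have weak-* accumulation points. -/
theorem exists_isWeakStarAccPt (hT : 0 < T) (hV : V.Nonempty) {w : ℕ → L1Space T M}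
    (hw : ∀ k, w k ∈ Uad T V) {p : ℝ≥0∞} (hp : 1 ≤ p)
    {C : ℝ≥0∞} (hC : C ≠ ⊤) (hwC : ∀ k, TVp p (w k) ≤ C) : ∃ v, IsWeakStarAccPt w v := by
  obtain ⟨φ, hφ, n, a, τ, t, hrep, ht⟩ := exists_subseq_isMinimalRep hT hV hw hp hC hwC
  obtain ⟨v, hv, hv'⟩ := exists_tendsto_of_isRep (fun k => (hrep k).isRep) ht
  exact ⟨v, φ, hφ, weakStarTendsto_of_isRep hT (fun k => (hrep k).isRep) hv ht hv'⟩

/-- Limits in `L^1` of controls with bounded total variation are controls. -/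
theorem mem_Uad_of_tendsto (hT : 0 < T) (hV : V.Nonempty) {w : ℕ → L1Space T M}
    {v : L1Space T M} (h : Tendsto w atTop (𝓝 v)) (hw : ∀ k, w k ∈ Uad T V) {p : ℝ≥0∞} (hp : 1 ≤ p)
    {C : ℝ≥0∞} (hC : C ≠ ⊤) (hwC : ∀ k, TVp p (w k) ≤ C) : v ∈ Uad T V := by
  obtain ⟨φ, hφ, n, a, τ, t, hrep, ht⟩ := exists_subseq_isMinimalRep hT hV hw hp hC hwC
  obtain ⟨v', hv, hv'⟩ := exists_tendsto_of_isRep (fun k => (hrep k).isRep) ht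
  rw [tendsto_nhds_unique (h.comp hφ.tendsto_atTop) hv']
  exact hv.mem_Uad hT

/-- Convergence of the total variation for one norm with `1 < p < ∞` implies convergence for all
norms. -/
theorem tendsto_TVp_of_tendsto_TVp (hT : 0 < T) (hV : V.Nonempty) {w : ℕ → L1Space T M}
    {v : L1Space T M} (h : Tendsto w atTop (𝓝 v)) (hw : ∀ k, w k ∈ Uad T V) {p : ℝ≥0∞} (hp : 1 < p)
    (hp' : p < ⊤) {C : ℝ≥0∞} (hC : C ≠ ⊤) (hwC : ∀ k, TVp p (w k) ≤ C)
    (hTV : Tendsto (fun k => TVp p (w k)) atTop (𝓝 (TVp p v))) {q : ℝ≥0∞} (hq : 1 ≤ q) :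
    Tendsto (fun k => TVp q (w k)) atTop (𝓝 (TVp q v)) := by
  refine tendsto_of_subseq_tendsto fun ns hns => ?_
  obtain ⟨φ, hφ, n, a, τ, t, hrep, ht⟩ :=
    exists_subseq_isMinimalRep hT hV (fun k => hw (ns k)) hp.le hC fun k => hwC (ns k)
  obtain ⟨v', hv, hv'⟩ := exists_tendsto_of_isRep (fun k => (hrep k).isRep) ht
  have he : v = v' := tendsto_nhds_unique ((h.comp hns).comp hφ.tendsto_atTop) hv'
  subst he
  -- Along the subsequence the jumps are fixed, so TV_p is constant. By hypothesis its limit is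
  -- TV_p(v), although the limit representation may be degenerate.
  have hTVv : TVp p v = ENNReal.ofReal (∑ j ∈ Finset.range (n - 1), pNorm p (jump a j)) := by
    refine tendsto_nhds_unique ((hTV.comp hns).comp hφ.tendsto_atTop) ?_
    refine tendsto_const_nhds.congr fun k => ?_
    exact ((hrep k).isRep.TVp_eq hT (hrep k).t_lt hp.le).symm
  refine ⟨φ, ?_⟩
  rw [hv.TVp_eq_of_eq hT hp hp' (hrep 0).a_ne hTVv hq]
  refine tendsto_const_nhds.congr fun k => ?_
  exact ((hrep k).isRep.TVp_eq hT (hrep k).t_lt hq).symm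

end

/-! ### Taylor estimate and descent by moving a switch -/

section

variable {T : ℝ} {M : ℕ}
variable {V : Finset (Fin M → ℤ)} {F : L1Space T M → ℝ}

theorem isC1Gradient_grad {v : L1Space T M} (h : ∃ g, IsC1Gradient F v g) :
    IsC1Gradient F v (grad F v) := by
  rw [grad, dif_pos h]; exact h.choose_spec

theorem memLp_of_mem_Uad {u : L1Space T M} (hu : u ∈ Uad T V) (q : ℝ≥0∞) :
    MemLp u q (volume.restrict (Ioo (0 : ℝ) T)) := by
  refine MemLp.of_bound (Lp.aestronglyMeasurable u) (∑ ν ∈ V, ∑ i, |(ν i : ℝ)|) ?_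
  filter_upwards [hu.2] with x ⟨ν, hν, hx⟩
  rw [PiLp.norm_eq_of_L1]
  simp_rw [hx]
  exact Finset.single_le_sum (f := fun ν : Fin M → ℤ => ∑ i, |(ν i : ℝ)|)
    (fun _ _ => Finset.sum_nonneg fun _ _ => abs_nonneg _) hν

/-- Keeps the segment between two controls in L^2, where the second derivative is bounded. -/
theorem convex_memLp (q : ℝ≥0∞) :
    Convex ℝ {ξ : L1Space T M | MemLp ξ q (volume.restrict (Ioo (0 : ℝ) T))} := by
  intro x hx y hy r s _ _ _
  have h : MemLp (r • (x : ℝ → PiLp 1 fun _ : Fin M => ℝ) + s • (y : ℝ → PiLp 1 fun _ : Fin M => ℝ)) q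
      (volume.restrict (Ioo (0 : ℝ) T)) :=
    (MemLp.const_smul hx r).add (MemLp.const_smul hy s)
  refine (memLp_congr_ae ?_).2 h
  filter_upwards [Lp.coeFn_add (r • x) (s • y), Lp.coeFn_smul r x, Lp.coeFn_smul s y] with t h1 h2 h3
  rw [h1, Pi.add_apply, Pi.add_apply, h2, h3]

/-- The first-order Taylor estimate between two controls. -/
theorem taylor_estimate (hF1 : Differentiable ℝ F) (hF2 : Differentiable ℝ (fderiv ℝ F))
    {C : ℝ} (hC : 0 ≤ C) (hbound : ∀ ξ : L1Space T M,
      MemLp ξ 2 (volume.restrict (Ioo (0 : ℝ) T)) →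
      ∀ v w : L1Space T M, |fderiv ℝ (fderiv ℝ F) ξ v w| ≤ C * ‖v‖ * ‖w‖)
    {v w : L1Space T M} (hv : v ∈ Uad T V) (hw : w ∈ Uad T V) :
    |F w - F v - fderiv ℝ F v (w - v)| ≤ C * ‖w - v‖ ^ 2 := by
  have hseg : ∀ ξ ∈ segment ℝ v w, MemLp ξ 2 (volume.restrict (Ioo (0 : ℝ) T)) := fun ξ hξ =>
    (convex_memLp 2).segment_subset (memLp_of_mem_Uad hv 2) (memLp_of_mem_Uad hw 2) hξ
  have hop : ∀ ξ ∈ segment ℝ v w, ‖fderiv ℝ (fderiv ℝ F) ξ‖ ≤ C := fun ξ hξ =>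
    ContinuousLinearMap.opNorm_le_bound₂ _ hC fun x y => hbound ξ (hseg ξ hξ) x y
  -- The mean value inequality is used twice, for F' and then for F minus its linearisation at v;
  -- this gives C in place of C/2.
  have hder : ∀ ξ ∈ segment ℝ v w, ‖fderiv ℝ F ξ - fderiv ℝ F v‖ ≤ C * ‖w - v‖ := fun ξ hξ => by
    refine ((convex_segment v w).norm_image_sub_le_of_norm_hasFDerivWithin_le
      (fun y _ => (hF2 y).hasFDerivAt.hasFDerivWithinAt) hop (left_mem_segment ℝ v w) hξ).trans ?_
    refine mul_le_mul_of_nonneg_left ?_ hC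
    obtain ⟨θ, hθ, rfl⟩ := (segment_eq_image' ℝ v w) ▸ hξ
    rw [add_sub_cancel_left, norm_smul, Real.norm_of_nonneg hθ.1]
    exact mul_le_of_le_one_left (norm_nonneg _) hθ.2
  have := (convex_segment v w).norm_image_sub_le_of_norm_hasFDerivWithin_le'
    (fun y _ => (hF1 y).hasFDerivAt.hasFDerivWithinAt) hder
    (left_mem_segment ℝ v w) (right_mem_segment ℝ v w)
  rw [Real.norm_eq_abs] at this
  linarith [this, sq (‖w - v‖), mul_assoc C ‖w - v‖ ‖w - v‖]

theorem IsC1Gradient.exists_bound {v : L1Space T M} {g : ℝ → Fin M → ℝ} (hg : IsC1Gradient F v g) :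
    ∃ G, ∀ᵐ x ∂(volume.restrict (Ioo (0 : ℝ) T)), ‖g x‖ ≤ G := by
  refine ⟨(eLpNormEssSup g (volume.restrict (Ioo (0 : ℝ) T))).toReal, ?_⟩
  have hfin : eLpNormEssSup g (volume.restrict (Ioo (0 : ℝ) T)) ≠ ⊤ := by
    have := hg.memLp_top.eLpNorm_ne_top
    rwa [eLpNorm_exponent_top] at this
  filter_upwards [ae_le_eLpNormEssSup (f := g) (μ := volume.restrict (Ioo (0 : ℝ) T))] with x hx
  rw [← toReal_enorm]
  exact ENNReal.toReal_mono hfin hx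

section MoveSwitch

variable {v z : L1Space T M} {n : ℕ} {t : ℕ → ℝ} {a : ℕ → Fin M → ℤ} {j : ℕ} {r : ℝ}

theorem update_self_le (hle : ∀ k < n, t k ≤ t (k + 1)) (h1 : t j ≤ r) (h2 : r ≤ t (j + 1 + 1)) :
    ∀ k < n, Function.update t (j + 1) r k ≤ Function.update t (j + 1) r (k + 1) := by
  intro k hk
  rcases eq_or_ne k j with rfl | hkj
  · rwa [Function.update_self, Function.update_of_ne (by omega)]
  rcases eq_or_ne k (j + 1) with rfl | hkj'
  · rwa [Function.update_self, Function.update_of_ne (by omega)]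
  · rw [Function.update_of_ne hkj', Function.update_of_ne (by omega)]
    exact hle k hk

theorem IsRep.exists_moved (h : IsRep V v n t a) (hj : j + 1 < n) (h1 : t j ≤ r)
    (h2 : r ≤ t (j + 1 + 1)) : ∃ z : L1Space T M, IsRep V z n (Function.update t (j + 1) r) a := by
  refine exists_of_partition ?_ ?_ (update_self_le h.t_le h1 h2) h.a_mem
  · rw [Function.update_of_ne (by omega), h.t_zero]
  · rw [Function.update_of_ne (by omega), h.t_last]

theorem IsRep.norm_sub_moved_le (h : IsRep V v n t a)
    (hz : IsRep V z n (Function.update t (j + 1) r) a) :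
    ‖z - v‖ ≤ 2 * (∑ i, ∑ j ∈ Finset.range n, |(a j i : ℝ)|) * |r - t (j + 1)| := by
  set B := ∑ i, ∑ j ∈ Finset.range n, |(a j i : ℝ)| with hB
  have hB0 : 0 ≤ B := Finset.sum_nonneg fun _ _ => Finset.sum_nonneg fun _ _ => abs_nonneg _
  have hint : Integrable ((uIcc (t (j + 1)) r).indicator fun _ => 2 * B) (volume : Measure ℝ) :=
    (integrableOn_const isCompact_uIcc.measure_lt_top.ne).integrable_indicator measurableSet_uIcc
  rw [norm_sub_eq_integral]
  calc ∫ x in Ioo (0 : ℝ) T, ∑ i, |z x i - v x i|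
      ≤ ∫ x in Ioo (0 : ℝ) T, (uIcc (t (j + 1)) r).indicator (fun _ => 2 * B) x := by
        refine integral_mono_ae (integrable_finsetSum _ fun i _ =>
          ((integrable_apply z i).sub (integrable_apply v i)).abs) hint.integrableOn ?_
        filter_upwards [h.ae_exists, hz.ae_eq, h.ae_sum_abs_le, hz.ae_sum_abs_le]
          with x ⟨k, hk, hxk, hvx⟩ hzx hv' hz'
        by_cases hx : x ∈ uIcc (t (j + 1)) r
        · rw [indicator_of_mem hx]
          calc ∑ i, |z x i - v x i| ≤ ∑ i, (|z x i| + |v x i|) :=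
                Finset.sum_le_sum fun i _ => abs_sub _ _
            _ ≤ 2 * B := by rw [Finset.sum_add_distrib]; linarith
        · rw [indicator_of_notMem hx]
          refine (Finset.sum_eq_zero fun i _ => ?_).le
          rw [mem_uIcc] at hx
          push Not at hx
          have hmem : x ∈ Ioo (Function.update t (j + 1) r k) (Function.update t (j + 1) r (k + 1)) := by
            rcases eq_or_ne k j with rfl | hkj
            · rw [Function.update_self, Function.update_of_ne (by omega)]
              exact ⟨hxk.1, not_le.1 fun h' => absurd hxk.2 (not_lt.2 (hx.2 h').le)⟩
            rcases eq_or_ne k (j + 1) with rfl | hkj'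
            · rw [Function.update_self, Function.update_of_ne (by omega)]
              exact ⟨hx.1 hxk.1.le, hxk.2⟩
            · rw [Function.update_of_ne hkj', Function.update_of_ne (by omega)]
              exact hxk
          rw [hzx k hk hmem i, hvx i, sub_self, abs_zero]
    _ ≤ ∫ x, (uIcc (t (j + 1)) r).indicator (fun _ => 2 * B) x :=
        setIntegral_le_integral hint (Eventually.of_forall fun x =>
          indicator_nonneg (fun _ _ => by positivity) x)
    _ = 2 * B * |r - t (j + 1)| := by
        rw [integral_indicator measurableSet_uIcc, setIntegral_const, measureReal_def,
          Real.volume_interval, ENNReal.toReal_ofReal (abs_nonneg _), smul_eq_mul, mul_comm]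

/-- Only the two intervals next to the switch contribute, and their differences combine to one
integral between its old and new position. The oriented integral covers both directions. -/
theorem IsRep.pairing_sub_moved (h : IsRep V v n t a)
    (hz : IsRep V z n (Function.update t (j + 1) r) a) (hT : 0 < T) (hj : j + 1 < n) (h1 : t j ≤ r)
    (h2 : r ≤ t (j + 1 + 1)) {g : ℝ → Fin M → ℝ}
    (hm : AEStronglyMeasurable g (volume.restrict (Ioo (0 : ℝ) T))) {B : ℝ}
    (hB : ∀ᵐ x ∂(volume.restrict (Ioo (0 : ℝ) T)), ‖g x‖ ≤ B) :
    ∫ x in Ioo (0 : ℝ) T, ∑ i, g x i * (v - z) x i =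
      -∫ x in t (j + 1)..r, ∑ i, ((a j i : ℝ) - (a (j + 1) i : ℝ)) * g x i := by
  have hint : ∀ k, IntegrableOn (fun x => ∑ i, g x i * (a k i : ℝ)) (Ioc 0 T) := fun k => by
    refine (integrableOn_Ioc_iff_integrableOn_Ioo (by simp)).2 (integrable_finsetSum _ fun i _ => ?_)
    refine Integrable.mul_const ?_ _
    refine Integrable.of_bound ((continuous_apply i).comp_aestronglyMeasurable hm) B ?_
    filter_upwards [hB] with x hx using (norm_le_pi_norm (g x) i).trans hx
  have h0 : 0 ≤ t j := by rw [← h.t_zero]; exact h.mono (Nat.zero_le _) (by omega)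
  have hn : t (j + 1 + 1) ≤ T := by rw [← h.t_last]; exact h.mono (by omega) le_rfl
  have h3 := h.t_le j (by omega)
  have h4 := h.t_le (j + 1) hj
  have hii : ∀ k x y, x ∈ Icc 0 T → y ∈ Icc 0 T →
      IntervalIntegrable (fun x => ∑ i, g x i * (a k i : ℝ)) volume x y := fun k x y hx hy => by
    refine intervalIntegrable_iff.2 ((hint k).mono_set ?_)
    exact Ioc_subset_Ioc (le_min hx.1 hy.1) (max_le hx.2 hy.2)
  have m1 : t j ∈ Icc 0 T := ⟨h0, by linarith⟩
  have m2 : t (j + 1) ∈ Icc 0 T := ⟨by linarith, by linarith⟩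
  have m3 : t (j + 1 + 1) ∈ Icc 0 T := ⟨by linarith, hn⟩
  have m4 : r ∈ Icc 0 T := ⟨by linarith, by linarith⟩
  rw [pairing_sub hm hB, h.pairing_eq hT hm hB, hz.pairing_eq hT hm hB, ← Finset.sum_sub_distrib,
    Finset.sum_eq_add j (j + 1) (by omega)]
  · rw [Function.update_self, Function.update_of_ne (by omega), Function.update_of_ne (by omega)]
    rw [intervalIntegral.integral_interval_sub_left (hii _ _ _ m1 m2) (hii _ _ _ m1 m4)]
    rw [intervalIntegral.integral_interval_sub_interval_comm (hii _ _ _ m2 m3) (hii _ _ _ m4 m3)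
      (hii _ _ _ m2 m4), intervalIntegral.integral_same, sub_zero,
      intervalIntegral.integral_symm (t (j + 1)) r, neg_add_eq_sub,
      ← intervalIntegral.integral_sub (hii _ _ _ m2 m4) (hii _ _ _ m2 m4),
      ← intervalIntegral.integral_neg]
    congr 1
    ext x
    rw [← Finset.sum_sub_distrib, ← Finset.sum_neg_distrib]
    exact Finset.sum_congr rfl fun i _ => by ring
  · intro k _ hk
    rw [Function.update_of_ne hk.2, Function.update_of_ne (by have := hk.1; omega), sub_self]
  · intro hj'; exact absurd (Finset.mem_range.2 (by omega)) hj'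
  · intro hj'; exact absurd (Finset.mem_range.2 (by omega)) hj'

end MoveSwitch

/-- Moving one switching point of a control that is not first-order stationary reduces the linear
model of the objective proportionally to the distance. -/
theorem exists_descent (hT : 0 < T) (hV : V.Nonempty) {v : L1Space T M} (hv : v ∈ Uad T V)
    (hg : IsC1Gradient F v (grad F v)) (hFO : ¬ FirstOrder F V v) :
    ∃ c > 0, ∃ D > 0, ∀ Δ, 0 < Δ → Δ < D → ∃ z ∈ Uad T V, ‖z - v‖ ≤ Δ ∧
      (∀ p : ℝ≥0∞, 1 ≤ p → TVp p z ≤ TVp p v) ∧ c * Δ ≤ fderiv ℝ F v (v - z) := by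
  classical
  obtain ⟨n, t, a, hrep⟩ := exists_isMinimalRep hT hV hv
  have hR := hrep.isRep
  obtain ⟨j, hj, hη⟩ : ∃ j, j + 1 < n ∧
      ∑ i, ((a j i : ℝ) - (a (j + 1) i : ℝ)) * grad F v (t (j + 1)) i ≠ 0 := by
    by_contra! h
    exact hFO ⟨n, t, a, hrep, h⟩
  set g := grad F v with hgdef
  set τ := t (j + 1) with hτ
  set h : ℝ → ℝ := fun x => ∑ i, ((a j i : ℝ) - (a (j + 1) i : ℝ)) * g x i with hh
  set η := h τ with hηdef
  change η ≠ 0 at hη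
  have hlt1 : t j < τ := hrep.t_lt j (by omega)
  have hlt2 : τ < t (j + 1 + 1) := hrep.t_lt (j + 1) hj
  have h0j : 0 ≤ t j := by rw [← hrep.t_zero]; exact hR.mono (Nat.zero_le _) (by omega)
  have hjT : t (j + 1 + 1) ≤ T := by
    have := hR.mono (i := j + 1 + 1) (j := n) (by omega) le_rfl
    rwa [hrep.t_last] at this
  have hτI : τ ∈ Ioo 0 T := ⟨by linarith, by linarith⟩
  have hgc : ContinuousOn g (Ioo 0 T) := hg.contDiffOn.continuousOn
  have hgm := hgc.aestronglyMeasurable (μ := volume) measurableSet_Ioo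
  obtain ⟨G, hG⟩ := hg.exists_bound
  have hhc : ContinuousOn h (Ioo 0 T) := by
    refine continuousOn_finsetSum _ fun i _ => ContinuousOn.mul continuousOn_const ?_
    exact (continuous_apply i).comp_continuousOn hgc
  obtain ⟨δ, hδ, hδh⟩ := Metric.continuousAt_iff.1 (hhc.continuousAt (isOpen_Ioo.mem_nhds hτI))
    (|η| / 2) (by positivity)
  set B : ℝ := 2 * ∑ i, ∑ j ∈ Finset.range n, |(a j i : ℝ)| with hB
  have hB0 : 0 ≤ B := mul_nonneg zero_le_two
    (Finset.sum_nonneg fun _ _ => Finset.sum_nonneg fun _ _ => abs_nonneg _)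
  set gap := min δ (min (τ - t j) (t (j + 1 + 1) - τ)) with hgap
  have hgap0 : 0 < gap := lt_min hδ (lt_min (by linarith) (by linarith))
  -- A shift by e changes the control by at most B e in L^1, so e = Δ/(B + 1) is admissible; the
  -- summand 1 avoids division by zero. The bound `gap` keeps the switch between its neighbours and
  -- h within |η|/2 of η.
  refine ⟨|η| / (2 * (B + 1)), by positivity, gap * (B + 1), by positivity, fun Δ hΔ hΔD => ?_⟩
  set e := Δ / (B + 1) with he
  have he0 : 0 < e := by positivity
  have heg : e < gap := (div_lt_iff₀ (by positivity)).2 hΔD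
  have hegδ : e < δ := heg.trans_le (min_le_left _ _)
  have heg1 : e < τ - t j := heg.trans_le ((min_le_right _ _).trans (min_le_left _ _))
  have heg2 : e < t (j + 1 + 1) - τ := heg.trans_le ((min_le_right _ _).trans (min_le_right _ _))
  -- The switch moves against the sign of η. The gain is |η| e up to an error of |η| e / 2.
  obtain ⟨s, hs, hsη⟩ : ∃ s : ℝ, |s| = e ∧ -(s * η) = |η| * e := by
    rcases lt_or_gt_of_ne hη with h' | h'
    · exact ⟨e, abs_of_pos he0, by rw [abs_of_neg h']; ring⟩
    · exact ⟨-e, by rw [abs_neg, abs_of_pos he0], by rw [abs_of_pos h']; ring⟩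
  have hs' := abs_le.1 hs.le
  have h1 : t j ≤ τ + s := by linarith
  have h2 : τ + s ≤ t (j + 1 + 1) := by linarith
  obtain ⟨z, hz⟩ := hR.exists_moved hj h1 h2
  refine ⟨z, hz.mem_Uad hT, ?_, fun p hp => ?_, ?_⟩
  · refine (hR.norm_sub_moved_le hz).trans ?_
    rw [← hτ, add_sub_cancel_left, hs, ← hB, he, mul_div_assoc', div_le_iff₀ (by positivity)]
    nlinarith
  -- The values, and so the jumps, are unchanged.
  · rw [hR.TVp_eq hT hrep.t_lt hp]
    exact hz.TVp_le hT hp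
  · rw [hg.represents, hR.pairing_sub_moved hz hT hj h1 h2 hgm hG, ← hτ]
    have hsub : uIcc τ (τ + s) ⊆ Ioo 0 T := by
      refine (ordConnected_Ioo (a := (0 : ℝ)) (b := T)).uIcc_subset hτI ⟨?_, ?_⟩ <;> linarith
    have hdiff : ‖∫ x in τ..τ + s, (h x - η)‖ ≤ |η| / 2 * |τ + s - τ| := by
      refine intervalIntegral.norm_integral_le_of_norm_le_const fun x hx => ?_
      refine (hδh ?_).le
      rw [Real.dist_eq]
      refine lt_of_le_of_lt ?_ hegδ
      have := abs_sub_left_of_mem_uIcc (uIoc_subset_uIcc hx)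
      rwa [add_sub_cancel_left, hs] at this
    rw [intervalIntegral.integral_sub (hhc.mono hsub).intervalIntegrable intervalIntegrable_const,
      intervalIntegral.integral_const, add_sub_cancel_left, smul_eq_mul, hs, Real.norm_eq_abs] at hdiff
    have h3 := (abs_le.1 hdiff).2
    have h4 : |η| / (2 * (B + 1)) * Δ = |η| / 2 * e := by rw [he]; field_simp
    rw [h4]
    linarith

end

/-! ### Analysis of the trust-region algorithm -/

section

variable {T : ℝ} {M : ℕ}

/-- The properties of the optimal control problem that the analysis of the trust-region algorithm
depends on. -/
structure IsControlProblem (p : ℝ≥0∞) (β : ℝ) (V : Finset (Fin M → ℤ)) (F : L1Space T M → ℝ)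
    (C : ℝ) : Prop where
  T_pos : 0 < T
  one_le_p : 1 ≤ p
  β_pos : 0 < β
  nonempty : V.Nonempty
  bddBelow : BddBelow (Set.range F)
  continuous_fderiv : Continuous (fderiv ℝ F)
  exists_grad : ∀ v ∈ Uad T V, ∃ g, IsC1Gradient F v g
  taylor : ∀ v ∈ Uad T V, ∀ w ∈ Uad T V, |F w - F v - fderiv ℝ F v (w - v)| ≤ C * ‖w - v‖ ^ 2

variable {p : ℝ≥0∞} {β : ℝ} {V : Finset (Fin M → ℤ)} {F : L1Space T M → ℝ} {C : ℝ}

theorem radius_pos {Δ₀ : ℝ} (hΔ₀ : 0 < Δ₀) (k : ℕ) : 0 < radius Δ₀ k := by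
  unfold radius; positivity

theorem radius_anti {Δ₀ : ℝ} (hΔ₀ : 0 < Δ₀) {k l : ℕ} (h : k ≤ l) : radius Δ₀ l ≤ radius Δ₀ k := by
  unfold radius
  exact div_le_div_of_nonneg_left hΔ₀.le (by positivity) (pow_le_pow_right₀ one_le_two h)

theorem tendsto_radius (Δ₀ : ℝ) : Tendsto (radius Δ₀) atTop (𝓝 0) := by
  have := (tendsto_pow_atTop_nhds_zero_of_lt_one (r := (1 / 2 : ℝ)) (by norm_num)
    (by norm_num)).const_mul Δ₀
  rw [mul_zero] at this
  refine this.congr fun k => ?_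
  rw [radius, one_div, inv_pow]; rfl

theorem trObjective_eq_neg_pred (p : ℝ≥0∞) (β : ℝ) (F : L1Space T M → ℝ) (v w : L1Space T M) :
    trObjective p β v (grad F v) w = -pred p β F v w := by
  have : ∫ t in Ioo (0 : ℝ) T, ∑ i, grad F v t i * (w t i - v t i)
      = -∫ t in Ioo (0 : ℝ) T, ∑ i, grad F v t i * (v t i - w t i) := by
    rw [← integral_neg]
    congr 1
    ext t
    rw [← Finset.sum_neg_distrib]
    exact Finset.sum_congr rfl fun i _ => by ring
  rw [trObjective, pred, this]; ring

theorem pred_self (p : ℝ≥0∞) (β : ℝ) (F : L1Space T M → ℝ) (v : L1Space T M) :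
    pred p β F v v = 0 := by simp [pred]

theorem SolvesTR.pred_le {v w z : L1Space T M} {Δ : ℝ}
    (h : SolvesTR p β V v (grad F v) Δ w) (hz : z ∈ Uad T V) (hzv : ‖z - v‖ ≤ Δ) :
    pred p β F v z ≤ pred p β F v w := by
  have := h.2.2 z hz hzv
  rw [trObjective_eq_neg_pred, trObjective_eq_neg_pred] at this
  linarith

theorem solvesTR_self_iff {v : L1Space T M} {Δ : ℝ} (hΔ : 0 < Δ) :
    SolvesTR p β V v (grad F v) Δ v ↔
      v ∈ Uad T V ∧ ∀ z ∈ Uad T V, ‖z - v‖ ≤ Δ → pred p β F v z ≤ 0 := by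
  unfold SolvesTR
  simp only [trObjective_eq_neg_pred, pred_self, sub_self, norm_zero, hΔ.le, true_and, neg_le_neg_iff]

namespace IsControlProblem

variable (h : IsControlProblem p β V F C)
include h

theorem TVp_ne_top {v : L1Space T M} (hv : v ∈ Uad T V) : TVp p v ≠ ⊤ := by
  obtain ⟨n, t, a, hrep⟩ := exists_isRep h.T_pos h.nonempty hv
  exact (hrep.TVp_lt_top h.T_pos h.one_le_p).ne

/-- Expresses the model by F'(v), which is continuous in v with respect to L^1, so that limits of
iterates can be taken without any continuity of `grad F v` in v. -/
theorem pred_eq {v : L1Space T M} (hv : v ∈ Uad T V) (w : L1Space T M) :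
    pred p β F v w = fderiv ℝ F v (v - w) + β * (TVp p v).toReal - β * (TVp p w).toReal := by
  have hg := isC1Gradient_grad (h.exists_grad v hv)
  rw [pred, hg.represents]
  congr 2
  refine integral_congr_ae ?_
  filter_upwards [coeFn_sub_apply v w] with x hx
  simp_rw [hx]

/-- The total variation enters both reductions exactly; they differ only by the linearisation error
of F. -/
theorem pred_sub_le_ared {v w : L1Space T M} (hv : v ∈ Uad T V) (hw : w ∈ Uad T V) :
    pred p β F v w - C * ‖w - v‖ ^ 2 ≤ ared p β F v w := by
  have h1 := (abs_le.1 (h.taylor v hv w hw)).2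
  rw [h.pred_eq hv, ared, objective, objective, ← neg_sub w v, map_neg]
  linarith

/-- A step is accepted if the radius is small compared to the reduction that some feasible point
of the subproblem predicts. -/
theorem accept (hC : 0 ≤ C) {σ : ℝ} (hσ1 : σ < 1) {v w z : L1Space T M} (hv : v ∈ Uad T V) {Δ : ℝ}
    (hw : SolvesTR p β V v (grad F v) Δ w) (hz : z ∈ Uad T V) (hzv : ‖z - v‖ ≤ Δ)
    (hΔ : C * Δ ^ 2 ≤ (1 - σ) * pred p β F v z) :
    σ * pred p β F v w ≤ ared p β F v w := by
  have h1 := hw.pred_le hz hzv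
  have h2 := h.pred_sub_le_ared hv hw.1
  have h3 : C * ‖w - v‖ ^ 2 ≤ C * Δ ^ 2 :=
    mul_le_mul_of_nonneg_left (pow_le_pow_left₀ (norm_nonneg _) hw.2.1 2) hC
  nlinarith

theorem exists_descent {v : L1Space T M} (hv : v ∈ Uad T V) (hFO : ¬ FirstOrder F V v) :
    ∃ c > 0, ∃ D > 0, ∀ Δ, 0 < Δ → Δ < D → ∃ z ∈ Uad T V, ‖z - v‖ ≤ Δ ∧
      (TVp p z).toReal ≤ (TVp p v).toReal ∧ c * Δ ≤ fderiv ℝ F v (v - z) := by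
  obtain ⟨c, hc, D, hD, H⟩ := SwitchingControl.exists_descent h.T_pos h.nonempty hv
    (isC1Gradient_grad (h.exists_grad v hv)) hFO
  refine ⟨c, hc, D, hD, fun Δ hΔ hΔD => ?_⟩
  obtain ⟨z, hz, h1, h2, h3⟩ := H Δ hΔ hΔD
  exact ⟨z, hz, h1, ENNReal.toReal_mono (h.TVp_ne_top hv) (h2 p h.one_le_p), h3⟩

theorem exists_pred_ge {v : L1Space T M} (hv : v ∈ Uad T V) (hFO : ¬ FirstOrder F V v) :
    ∃ c > 0, ∃ D > 0, ∀ Δ, 0 < Δ → Δ < D → ∃ z ∈ Uad T V, ‖z - v‖ ≤ Δ ∧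
      c * Δ ≤ pred p β F v z := by
  obtain ⟨c, hc, D, hD, H⟩ := h.exists_descent hv hFO
  refine ⟨c, hc, D, hD, fun Δ hΔ hΔD => ?_⟩
  obtain ⟨z, hz, h1, h2, h3⟩ := H Δ hΔ hΔD
  refine ⟨z, hz, h1, ?_⟩
  rw [h.pred_eq hv]
  have := mul_le_mul_of_nonneg_left h2 h.β_pos.le
  linarith

theorem firstOrder_of_solvesTR {v : L1Space T M} {Δ : ℝ} (hΔ : 0 < Δ)
    (hs : SolvesTR p β V v (grad F v) Δ v) : FirstOrder F V v := by
  by_contra hFO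
  obtain ⟨c, hc, D, hD, H⟩ := h.exists_pred_ge hs.1 hFO
  have hm : 0 < min Δ (D / 2) := lt_min hΔ (by linarith)
  obtain ⟨z, hz, h1, h2⟩ := H _ hm (by linarith [min_le_right Δ (D / 2)])
  have := ((solvesTR_self_iff hΔ).1 hs).2 z hz (h1.trans (min_le_left _ _))
  have : 0 < c * min Δ (D / 2) := by positivity
  linarith

omit h in
/-- For every factor `c > 0` the radius is eventually so small that `C Δ² ≤ (1 - σ) c Δ`. -/
theorem exists_small_radius {Δ₀ σ : ℝ} (hΔ₀ : 0 < Δ₀) (hσ1 : σ < 1) {c D : ℝ}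
    (hc : 0 < c) (hD : 0 < D) :
    ∃ k, radius Δ₀ k < D ∧ C * radius Δ₀ k ^ 2 ≤ (1 - σ) * (c * radius Δ₀ k) := by
  have h1 : ∀ᶠ k in atTop, radius Δ₀ k < D := (tendsto_radius Δ₀).eventually_lt_const hD
  have h2 : ∀ᶠ k in atTop, C * radius Δ₀ k < (1 - σ) * c := by
    have := (tendsto_radius Δ₀).const_mul C
    rw [mul_zero] at this
    exact this.eventually_lt_const (mul_pos (by linarith) hc)
  obtain ⟨k, hk1, hk2⟩ := (h1.and h2).exists
  refine ⟨k, hk1, ?_⟩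
  have := mul_le_mul_of_nonneg_right hk2.le (radius_pos hΔ₀ k).le
  linarith

/-- At a nonstationary centre the predicted reduction is at least linear in the radius and the model
error at most quadratic, so some radius would be accepted. -/
theorem firstOrder_of_infinite_inner (hC : 0 ≤ C) {Δ₀ σ : ℝ} (hΔ₀ : 0 < Δ₀) (hσ1 : σ < 1)
    {v : L1Space T M} (hv : v ∈ Uad T V) {c : ℕ → L1Space T M}
    (hs : ∀ k, SolvesTR p β V v (grad F v) (radius Δ₀ k) (c k) ∧
      ared p β F v (c k) < σ * pred p β F v (c k)) : FirstOrder F V v := by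
  by_contra hFO
  obtain ⟨b, hb, D, hD, H⟩ := h.exists_pred_ge hv hFO
  obtain ⟨k, hk1, hk2⟩ := exists_small_radius (C := C) hΔ₀ hσ1 hb hD
  obtain ⟨z, hz, h1, h2⟩ := H _ (radius_pos hΔ₀ k) hk1
  refine absurd (hs k).2 (not_lt.2 (h.accept hC hσ1 hv (hs k).1 hz h1 (hk2.trans ?_)))
  exact mul_le_mul_of_nonneg_left h2 (by linarith)

section Run

variable {Δ₀ σ : ℝ} {u : ℕ → L1Space T M} {c : ℕ → ℕ → L1Space T M} {κ : ℕ → ℕ} {N : ℕ∞}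
  (hrun : IsTrustRegionRun p β V F Δ₀ σ u c κ N)
include hrun

omit h in
theorem iterate_mem_Uad : ∀ n : ℕ, (n : ℕ∞) ≤ N → u n ∈ Uad T V := by
  intro n hn
  rcases n with _ | n
  · exact hrun.init
  · have hlt : (n : ℕ∞) < N := lt_of_lt_of_le (by exact_mod_cast Nat.lt_succ_self n) hn
    obtain ⟨h1, -, -, -, h5⟩ := hrun.step n hlt
    rw [h5]
    exact (h1 (κ n) le_rfl).1

omit h in
theorem objective_decrease (hσ0 : 0 < σ) (n : ℕ) (hn : (n : ℕ∞) < N) :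
    0 < pred p β F (u n) (u (n + 1)) ∧
    σ * pred p β F (u n) (u (n + 1)) ≤ objective p β F (u n) - objective p β F (u (n + 1)) ∧
    objective p β F (u (n + 1)) < objective p β F (u n) := by
  obtain ⟨-, -, h3, h4, h5⟩ := hrun.step n hn
  rw [← h5] at h3 h4
  refine ⟨h3, h4, ?_⟩
  have := mul_pos hσ0 h3
  rw [ared] at h4
  linarith

end Run

/-! ### Limits of infinite runs -/

section InfiniteRun

variable {Δ₀ σ : ℝ} {u : ℕ → L1Space T M} {c : ℕ → ℕ → L1Space T M} {κ : ℕ → ℕ}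
  (hrun : IsTrustRegionRun p β V F Δ₀ σ u c κ ⊤)
include hrun

omit h in
theorem iterate_mem (n : ℕ) : u n ∈ Uad T V := iterate_mem_Uad hrun n le_top

omit h in
theorem objective_strictAnti (hσ0 : 0 < σ) : StrictAnti fun n => objective p β F (u n) :=
  strictAnti_nat_of_succ_lt fun n => (objective_decrease hrun hσ0 n (ENat.natCast_lt_top n)).2.2

/-- The total variation of the iterates is bounded. -/
theorem exists_TVp_bound (hσ0 : 0 < σ) : ∃ K : ℝ≥0∞, K ≠ ⊤ ∧ ∀ n, TVp p (u n) ≤ K := by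
  obtain ⟨m, hm⟩ := h.bddBelow
  refine ⟨ENNReal.ofReal ((objective p β F (u 0) - m) / β), ENNReal.ofReal_ne_top, fun n => ?_⟩
  rw [← ENNReal.ofReal_toReal (h.TVp_ne_top (iterate_mem hrun n))]
  refine ENNReal.ofReal_le_ofReal ((le_div_iff₀ h.β_pos).2 ?_)
  have h1 := (objective_strictAnti hrun hσ0).antitone (Nat.zero_le n)
  have h2 : m ≤ F (u n) := hm ⟨_, rfl⟩
  simp only [objective] at h1 ⊢
  linarith

/-- The predicted reductions of the accepted steps tend to zero. -/
theorem tendsto_pred (hσ0 : 0 < σ) :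
    Tendsto (fun n => pred p β F (u n) (u (n + 1))) atTop (𝓝 0) := by
  obtain ⟨m, hm⟩ := h.bddBelow
  have hbdd : BddBelow (Set.range fun n => objective p β F (u n)) := by
    refine ⟨m, ?_⟩
    rintro _ ⟨n, rfl⟩
    have h1 : m ≤ F (u n) := hm ⟨_, rfl⟩
    have h2 : 0 ≤ β * (TVp p (u n)).toReal := mul_nonneg h.β_pos.le ENNReal.toReal_nonneg
    simp only [objective]; linarith
  -- The objective values converge, so their successive differences tend to zero, and these dominate
  -- σ times the predicted reductions.
  have hlim := tendsto_atTop_ciInf (objective_strictAnti hrun hσ0).antitone hbdd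
  have hdiff := (hlim.sub (hlim.comp (tendsto_add_atTop_nat 1))).div_const σ
  rw [sub_self, zero_div] at hdiff
  refine squeeze_zero (fun n => (objective_decrease hrun hσ0 n (ENat.natCast_lt_top n)).1.le)
    (fun n => ?_) hdiff
  rw [le_div_iff₀ hσ0, mul_comm]
  exact (objective_decrease hrun hσ0 n (ENat.natCast_lt_top n)).2.1

/-- Every feasible point predicts at most the reduction of the accepted step, unless it predicts
too little to enforce the acceptance of the step. -/
theorem pred_le_accepted (hC : 0 ≤ C) (hΔ₀ : 0 < Δ₀) (hσ1 : σ < 1) {n k : ℕ} {z : L1Space T M}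
    (hz : z ∈ Uad T V) (hzn : ‖z - u n‖ ≤ radius Δ₀ k)
    (hk : C * radius Δ₀ k ^ 2 ≤ (1 - σ) * pred p β F (u n) z) :
    pred p β F (u n) z ≤ pred p β F (u n) (u (n + 1)) := by
  obtain ⟨h1, h2, -, -, h5⟩ := hrun.step n (ENat.natCast_lt_top n)
  -- With radius index k the step would be accepted, so the inner loop ends no later. The accepted
  -- radius is at least that of k, and z is feasible for its subproblem.
  have hκ : κ n ≤ k := by
    by_contra! hlt
    exact absurd (h2 k hlt).2
      (not_lt.2 (h.accept hC hσ1 (iterate_mem hrun n) (h1 k hlt.le) hz hzn hk))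
  rw [h5]
  exact (h1 (κ n) le_rfl).pred_le hz (hzn.trans (radius_anti hΔ₀ hκ))

variable {ns : ℕ → ℕ} (hns : StrictMono ns) {v : L1Space T M}
  (hlim : Tendsto (u ∘ ns) atTop (𝓝 v))
include hns hlim

omit h hrun hns in
theorem tendsto_norm_sub (z : L1Space T M) :
    Tendsto (fun l => ‖z - u (ns l)‖) atTop (𝓝 ‖z - v‖) :=
  (tendsto_const_nhds.sub hlim).norm

omit hrun hns in
theorem tendsto_fderiv_sub (z : L1Space T M) :
    Tendsto (fun l => fderiv ℝ F (u (ns l)) (u (ns l) - z)) atTop (𝓝 (fderiv ℝ F v (v - z))) :=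
  ((h.continuous_fderiv.clm_apply (continuous_id.sub continuous_const)).tendsto v).comp hlim

/-- For large l the competitor z is feasible at radius index k, and it predicts less than ρ, as
otherwise the accepted steps would predict at least ρ infinitely often. The second ρ pays for
replacing F'(u)(u - z) by its limit. The variation of the iterates is kept, since its convergence is
only derived from this estimate. -/
theorem eventually_model_lt (hC : 0 ≤ C) (hΔ₀ : 0 < Δ₀) (hσ0 : 0 < σ) (hσ1 : σ < 1)
    {z : L1Space T M} (hz : z ∈ Uad T V) {k : ℕ} (hzv : ‖z - v‖ < radius Δ₀ k) {ρ : ℝ} (hρ : 0 < ρ)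
    (hk : C * radius Δ₀ k ^ 2 ≤ (1 - σ) * ρ) :
    ∀ᶠ l in atTop, fderiv ℝ F v (v - z) + β * (TVp p (u (ns l))).toReal - β * (TVp p z).toReal
      < 2 * ρ := by
  have e1 := (tendsto_norm_sub hlim z).eventually_lt_const hzv
  have e2 := ((h.tendsto_pred hrun hσ0).comp hns.tendsto_atTop).eventually_lt_const hρ
  have e3 := (h.tendsto_fderiv_sub hlim z).eventually_const_lt
    (show fderiv ℝ F v (v - z) - ρ < fderiv ℝ F v (v - z) by linarith)
  filter_upwards [e1, e2, e3] with l h1 h2 h3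
  have h4 : pred p β F (u (ns l)) z < ρ := by
    by_contra! hge
    have := h.pred_le_accepted hrun hC hΔ₀ hσ1 hz h1.le
      (hk.trans (mul_le_mul_of_nonneg_left hge (by linarith)))
    simp only [Function.comp] at h2
    linarith
  rw [h.pred_eq (iterate_mem hrun (ns l))] at h4
  linarith

omit hns in
theorem limit_mem_Uad (hσ0 : 0 < σ) : v ∈ Uad T V := by
  obtain ⟨K, hK, hKu⟩ := h.exists_TVp_bound hrun hσ0
  exact mem_Uad_of_tendsto h.T_pos h.nonempty hlim (fun l => iterate_mem hrun (ns l)) h.one_le_p hK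
    fun l => hKu (ns l)

theorem tendsto_toReal_TVp (hC : 0 ≤ C) (hΔ₀ : 0 < Δ₀) (hσ0 : 0 < σ) (hσ1 : σ < 1) :
    Tendsto (fun l => (TVp p (u (ns l))).toReal) atTop (𝓝 (TVp p v).toReal) := by
  have hv := h.limit_mem_Uad hrun hlim hσ0
  refine tendsto_order.2 ⟨fun b hb => ?_, fun b hb => ?_⟩
  · have h1 : ENNReal.ofReal (max b 0) < TVp p v ∨ b < 0 := by
      rcases lt_or_ge b 0 with h0 | h0
      · exact Or.inr h0
      · left
        rw [max_eq_left h0]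
        exact (ENNReal.ofReal_lt_iff_lt_toReal h0 (h.TVp_ne_top hv)).2 hb
    rcases h1 with h1 | h1
    · filter_upwards [hlim.eventually (lowerSemicontinuous_TVp p v _ h1)] with l hl
      exact (le_max_left b 0).trans_lt ((ENNReal.ofReal_lt_iff_lt_toReal (le_max_right _ _)
        (h.TVp_ne_top (iterate_mem hrun (ns l)))).1 hl)
    · exact Eventually.of_forall fun l => h1.trans_le ENNReal.toReal_nonneg
  -- The upper bound takes v itself as the competitor: β TV_p of the iterates is eventually below β
  -- TV_p(v) + 2ρ = β b.
  · set ρ := β * (b - (TVp p v).toReal) / 2 with hρ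
    have hρ0 : 0 < ρ := by have := mul_pos h.β_pos (sub_pos.2 hb); positivity
    have hk : ∃ k, C * radius Δ₀ k ^ 2 ≤ (1 - σ) * ρ := by
      have := ((tendsto_radius Δ₀).pow 2).const_mul C
      rw [zero_pow two_ne_zero, mul_zero] at this
      obtain ⟨k, hk⟩ := (this.eventually_lt_const (mul_pos (sub_pos.2 hσ1) hρ0)).exists
      exact ⟨k, hk.le⟩
    obtain ⟨k, hk⟩ := hk
    filter_upwards [h.eventually_model_lt hrun hns hlim hC hΔ₀ hσ0 hσ1 hv (k := k)
      (by rw [sub_self, norm_zero]; exact radius_pos hΔ₀ k) hρ0 hk] with l hl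
    rw [sub_self, map_zero, hρ] at hl
    have : β * (TVp p (u (ns l))).toReal < β * b := by linarith
    exact lt_of_mul_lt_mul_left this h.β_pos.le

theorem limit_firstOrder (hC : 0 ≤ C) (hΔ₀ : 0 < Δ₀) (hσ0 : 0 < σ) (hσ1 : σ < 1) :
    FirstOrder F V v := by
  have hv := h.limit_mem_Uad hrun hlim hσ0
  by_contra hFO
  obtain ⟨b, hb, D, hD, H⟩ := h.exists_descent hv hFO
  obtain ⟨k, hk1, hk2⟩ := exists_small_radius (C := C) hΔ₀ hσ1 (show 0 < b / 8 by positivity) hD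
  have hr := radius_pos hΔ₀ k
  -- Half the radius r leaves room for the distance of the iterates to v. The linear gain is at
  -- least b r / 2, the variation of the iterates costs less than b r / 8, but the model is
  -- eventually below 2 (b r / 8), a contradiction.
  obtain ⟨z, hz, h1, h2, h3⟩ := H (radius Δ₀ k / 2) (by linarith) (by linarith)
  have hρ : 0 < b / 8 * radius Δ₀ k := by positivity
  have e1 := h.eventually_model_lt hrun hns hlim hC hΔ₀ hσ0 hσ1 hz (h1.trans_lt (by linarith)) hρ hk2
  have e2 := ((h.tendsto_toReal_TVp hrun hns hlim hC hΔ₀ hσ0 hσ1).const_mul β).eventually_const_lt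
    (show β * (TVp p v).toReal - b / 8 * radius Δ₀ k < β * (TVp p v).toReal by linarith)
  obtain ⟨l, hl1, hl2⟩ := (e1.and e2).exists
  have := mul_le_mul_of_nonneg_left h2 h.β_pos.le
  linarith

theorem limit_solvesTR (hC : 0 ≤ C) (hΔ₀ : 0 < Δ₀) (hσ0 : 0 < σ) (hσ1 : σ < 1) {δ : ℝ} (hδ : 0 < δ)
    (hκ : ∀ l, δ ≤ radius Δ₀ (κ (ns l))) : SolvesTR p β V v (grad F v) (δ / 2) v := by
  have hv := h.limit_mem_Uad hrun hlim hσ0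
  refine (solvesTR_self_iff (half_pos hδ)).2 ⟨hv, fun z hz hzv => ?_⟩
  have hpred : Tendsto (fun l => pred p β F (u (ns l)) z) atTop (𝓝 (pred p β F v z)) := by
    simp_rw [h.pred_eq hv, h.pred_eq (iterate_mem hrun (ns _))]
    exact ((h.tendsto_fderiv_sub hlim z).add
      ((h.tendsto_toReal_TVp hrun hns hlim hC hΔ₀ hσ0 hσ1).const_mul β)).sub_const _
  refine le_of_tendsto_of_tendsto hpred ((h.tendsto_pred hrun hσ0).comp hns.tendsto_atTop) ?_
  -- A point within δ/2 of v is eventually within δ of the iterates, hence feasible for the accepted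
  -- subproblems, whose predicted reductions tend to zero.
  filter_upwards [(tendsto_norm_sub hlim z).eventually_lt_const (show ‖z - v‖ < δ by linarith)]
    with l hl
  obtain ⟨h1, -, -, -, h5⟩ := hrun.step (ns l) (ENat.natCast_lt_top _)
  simp only [Function.comp]
  rw [h5]
  exact (h1 _ le_rfl).pred_le hz (hl.le.trans (hκ l))

end InfiniteRun

end IsControlProblem

end

end SwitchingControl

end

/-! ### The three outcomes of the algorithm -/

theorem mainTheorem3 {M : ℕ} (T : ℝ) (hT : 0 < T) (p : ℝ≥0∞) (hp : 1 ≤ p)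
    (β : ℝ) (hβ : 0 < β) (V : Finset (Fin M → ℤ)) (hV : 2 ≤ V.card)
    (F : L1Space T M → ℝ) (hFbdd : BddBelow (Set.range F))
    -- `F` is twice Fréchet differentiable
    (hF1 : Differentiable ℝ F) (hF2 : Differentiable ℝ (fderiv ℝ F))
    -- `∇F(v) ∈ C^1(0,T)^M` for all admissible `v`
    (hFgrad : ∀ v ∈ Uad T V, ∃ g, IsC1Gradient F v g)
    -- `F''(ξ)` is uniformly bounded for all `ξ ∈ L^2(0,T)^M`
    (hFbound : ∃ C : ℝ, 0 ≤ C ∧ ∀ ξ : L1Space T M,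
      MemLp ξ 2 (volume.restrict (Ioo (0 : ℝ) T)) →
      ∀ v w : L1Space T M, |fderiv ℝ (fderiv ℝ F) ξ v w| ≤ C * ‖v‖ * ‖w‖)
    (Δ₀ : ℝ) (hΔ₀ : 0 < Δ₀) (σ : ℝ) (hσ0 : 0 < σ) (hσ1 : σ < 1)
    (u : ℕ → L1Space T M) (c : ℕ → ℕ → L1Space T M) (κ : ℕ → ℕ) (N : ℕ∞)
    (hrun : IsTrustRegionRun p β V F Δ₀ σ u c κ N) :
    (∀ n : ℕ, (n : ℕ∞) ≤ N → u n ∈ Uad T V) ∧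
    (∀ n : ℕ, (n : ℕ∞) < N → objective p β F (u (n + 1)) < objective p β F (u n)) ∧
    ExactlyOne
      -- finitely many iterates, the last one solves its subproblem
      (∃ n : ℕ, N = (n : ℕ∞) ∧
        (∃ Δ > 0, SolvesTR p β V (u n) (grad F (u n)) Δ (u n)) ∧ FirstOrder F V (u n))
      -- finitely many iterates, the inner loop does not terminate for the last one
      (∃ n : ℕ, N = (n : ℕ∞) ∧
        (∀ k, SolvesTR p β V (u n) (grad F (u n)) (radius Δ₀ k) (c n k) ∧
          0 < pred p β F (u n) (c n k) ∧
          ared p β F (u n) (c n k) < σ * pred p β F (u n) (c n k)) ∧ FirstOrder F V (u n))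
      -- infinitely many iterates
      (N = ⊤ ∧
        (∃ v, IsWeakStarAccPt u v) ∧
        (∀ v, IsWeakStarAccPt u v → v ∈ Uad T V ∧ FirstOrder F V v) ∧
        (∀ (v : L1Space T M) (ns : ℕ → ℕ), StrictMono ns → WeakStarTendsto (u ∘ ns) v →
          Tendsto (u ∘ ns) atTop (𝓝 v) ∧
          Tendsto (fun l => TVp p (u (ns l))) atTop (𝓝 (TVp p v)) ∧
          (1 < p → p < ⊤ → ∀ q : ℝ≥0∞, 1 ≤ q →
            Tendsto (fun l => TVp q (u (ns l))) atTop (𝓝 (TVp q v)))) ∧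
        (∀ ns : ℕ → ℕ, StrictMono ns →
          (∃ δ > 0, ∀ l, ∀ k ≤ κ (ns l), δ ≤ radius Δ₀ k) →
          ∀ v, IsWeakStarAccPt (u ∘ ns) v →
            ∃ Δ > 0, SolvesTR p β V v (grad F v) Δ v)) := by
  obtain ⟨C, hC, hbound⟩ := hFbound
  have hVne : V.Nonempty := Finset.card_pos.1 (by omega)
  have h : IsControlProblem p β V F C := ⟨hT, hp, hβ, hVne, hFbdd, hF2.continuous, hFgrad,
    fun v hv w hw => taylor_estimate hF1 hF2 hC hbound hv hw⟩
  refine ⟨IsControlProblem.iterate_mem_Uad hrun,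
    fun n hn => (IsControlProblem.objective_decrease hrun hσ0 n hn).2.2, ?_, ?_, ?_, ?_⟩
  · rcases eq_or_ne N ⊤ with rfl | hN
    · right; right
      obtain ⟨K, hK, hKu⟩ := h.exists_TVp_bound hrun hσ0
      have hmem := IsControlProblem.iterate_mem hrun
      have hL1 : ∀ (v : L1Space T M) (ns : ℕ → ℕ), WeakStarTendsto (u ∘ ns) v →
          Tendsto (u ∘ ns) atTop (𝓝 v) := fun v ns hw =>
        hw.tendsto hT hVne (fun k => hmem (ns k)) hp hK fun k => hKu (ns k)
      refine ⟨rfl, exists_isWeakStarAccPt hT hVne hmem hp hK hKu, ?_, ?_, ?_⟩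
      · rintro v ⟨ns, hns, hw⟩
        have hlim := hL1 v ns hw
        exact ⟨h.limit_mem_Uad hrun hlim hσ0, h.limit_firstOrder hrun hns hlim hC hΔ₀ hσ0 hσ1⟩
      · intro v ns hns hw
        have hlim := hL1 v ns hw
        have hTV : Tendsto (fun l => TVp p (u (ns l))) atTop (𝓝 (TVp p v)) :=
          (ENNReal.tendsto_toReal_iff (fun l => h.TVp_ne_top (hmem (ns l)))
            (h.TVp_ne_top (h.limit_mem_Uad hrun hlim hσ0))).1
            (h.tendsto_toReal_TVp hrun hns hlim hC hΔ₀ hσ0 hσ1)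
        exact ⟨hlim, hTV, fun hp1 hp2 q hq => tendsto_TVp_of_tendsto_TVp hT hVne hlim
          (fun k => hmem (ns k)) hp1 hp2 hK (fun k => hKu (ns k)) hTV hq⟩
      · rintro ns hns ⟨δ, hδ, hκ⟩ v ⟨ms, hms, hw⟩
        exact ⟨δ / 2, half_pos hδ, h.limit_solvesTR hrun (hns.comp hms) (hL1 v (ns ∘ ms) hw)
          hC hΔ₀ hσ0 hσ1 hδ fun l => hκ (ms l) _ le_rfl⟩
    · lift N to ℕ using hN
      have hmem := IsControlProblem.iterate_mem_Uad hrun N le_rfl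
      rcases hrun.final N rfl with ⟨h1, -, h3⟩ | hinf
      · left
        -- The subproblem solution maximises the predicted reduction. If this is not positive, the
        -- centre itself is optimal.
        have hs : SolvesTR p β V (u N) (grad F (u N)) (radius Δ₀ (κ N)) (u N) :=
          (solvesTR_self_iff (radius_pos hΔ₀ _)).2 ⟨hmem, fun z hz hzv =>
            ((h1 _ le_rfl).pred_le hz hzv).trans h3⟩
        exact ⟨N, rfl, ⟨_, radius_pos hΔ₀ _, hs⟩, h.firstOrder_of_solvesTR (radius_pos hΔ₀ _) hs⟩
      · right; left
        exact ⟨N, rfl, hinf, h.firstOrder_of_infinite_inner hC hΔ₀ hσ1 hmem fun k =>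
          ⟨(hinf k).1, (hinf k).2.2⟩⟩
  · rintro ⟨⟨n, hn, ⟨Δ, hΔ, hs⟩, -⟩, ⟨m, hm, hinf, -⟩⟩
    have hnm : n = m := by exact_mod_cast hn.symm.trans hm
    subst hnm
    -- Once the inner radius is below Δ, optimality of the centre forbids the positive predicted
    -- reduction of the inner candidate.
    obtain ⟨k, hk⟩ := ((tendsto_radius Δ₀).eventually_lt_const hΔ).exists
    have := ((solvesTR_self_iff hΔ).1 hs).2 _ (hinf k).1.1 ((hinf k).1.2.1.trans hk.le)
    linarith [(hinf k).2.1]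
  · rintro ⟨⟨n, hn, -⟩, ⟨hN, -⟩⟩
    exact ENat.natCast_ne_top n (hn.symm.trans hN)
  · rintro ⟨⟨n, hn, -⟩, ⟨hN, -⟩⟩
    exact ENat.natCast_ne_top n (hn.symm.trans hN)
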